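/- Let $\mathbb{K}$ be an ordinary differential field with derivation $\partial$, let $X=\{x_1,\dots,x_n\}$ and $U=\{u_1,\dots,u_{n-1}\}$ be differential indeterminates over $\mathbb{K}$, and write $x_{ik}=\partial^k x_i$, $u_{jk}=\partial^k u_j$. Let $$x_i=P_i(U),\qquad i=1,\dots,n,$$ be a system with $P_i\in\mathbb{K}\{U\}$ of degree at most $1$, not all $P_i$ in $\mathbb{K}$, such that every $u_j$ occurs (with some derivative) in some $P_i$. Let $a_i\in\mathbb{K}$ be the constant term of $P_i$, put $F_i=x_i-P_i(U)$, and let $$\mathrm{ID}=\{f\in\mathbb{K}\{X\}\mid f(P_1(U),\dots,P_n(U))=0\}.$$ The dimension of $\mathrm{ID}$ is $n-|\mathcal{C}|$ for a characteristic set $\mathcal{C}$ of $\mathrm{ID}$. Let $\mathrm{ord}(F_i,u_j)$ be the order of $F_i$ in $u_j$ ($-1$ if no derivative of $u_j$ occurs), let $o_i\ge 0$ be the order of $F_i$ in $U$ (with $o_i=0$ if $P_i\in\mathbb{K}$), $N=\sum_i o_i$, $\gamma_j=\min_i\{o_i-\mathrm{ord}(F_i,u_j)\}$, $\gamma=\sum_j\gamma_j$,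 $$\mathrm{PS}=\{\partial^kF_i\mid 1\le i\le n,\ 0\le k\le N-o_i-\gamma\},$$ $$\mathcal{X}=\{x_{ik}\mid 0\le k\le N-o_i-\gamma\},\qquad \mathcal{V}=\{u_{jk}\mid 0\le k\le N-\gamma_j-\gamma\},$$ and let $(\mathrm{PS})$ be the ideal generated by $\mathrm{PS}$ in $\mathbb{K}[\mathcal{X}][\mathcal{V}]$. Let $\mathcal{G}$ be the reduced Gröbner basis of $(\mathrm{PS})$ with respect to the lexicographic order in which every $x_{ik}$ is smaller than every $u_{jl}$, the derivatives of the $x_i$ are ordered by $x_n<\partial x_n<\partial^2x_n<\cdots<x_{n-1}<\partial x_{n-1}<\cdots<x_1<\partial x_1<\cdots$, and the derivatives of the $u_j$ by $u_1<\cdots<u_{n-1}<\partial u_1<\cdots<\partial u_{n-1}<\partial^2u_1<\cdots$. Let $\mathcal{G}_0=\mathcal{G}\cap\mathbb{K}\{X\}$, and let $(\mathcal{G}_0)$ be the ideal generated by $\mathcal{G}_0$ in $\mathbb{K}[\mathcal{X}]$. A nonzero linear (degree at most $1$) $B\in\mathrm{ID}$ can be written as $B=\sum_i\mathcal{F}_i(x_i-a_i)$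 with $\mathcal{F}_i$ in the ring $\mathbb{K}[\partial]$ of differential operators; it is called $\mathrm{ID}$-primitive if the greatest common left divisor of $\mathcal{F}_1,\dots,\mathcal{F}_n$ is in $\mathbb{K}$. The co-order $\mathrm{c}(B)$ of a nonzero linear $B\in(\mathrm{PS})$ is the highest integer $c\ge0$ such that $\partial^cB\in(\mathrm{PS})$. For $A\in\mathbb{K}\{X\}$ let $[A]$ be the differential ideal of $\mathbb{K}\{X\}$ generated by $A$. **Theorem.** Suppose that $\dim\mathrm{ID}=n-1$. Then: 1. There is a nonzero linear differential polynomial $A\in\mathbb{K}\{X\}$ such that $\mathrm{ID}=[A]$, $A$ is $\mathrm{ID}$-primitive, $A\in(\mathcal{G}_0)$, and $|\mathcal{G}_0|=\mathrm{c}(A)+1$. 2. For every nonzero linear $\mathrm{ID}$-primitive differential polynomial $A\in(\mathcal{G}_0)$ one has $\mathrm{ID}=[A]$ and $|\mathcal{G}_0|=\mathrm{c}(A)+1$. -/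

import Mathlib

open MvPolynomial
open scoped Differential

namespace LinearDPPE

noncomputable section

/-! ### Differential polynomials over an ordinary differential field -/

/-- The ring `K{Y}` of differential polynomials in the differential indeterminates `y : ι`.
The variable `(y, k)` is the `k`-th derivative of `y`. -/
abbrev DiffPoly (K : Type*) [Field K] (ι : Type*) : Type _ := MvPolynomial (ι × ℕ) K

/-- The additive map differentiating the coefficients of a polynomial. -/
def coeffDeriv {K : Type*} [Field K] [Differential K] (σ : Type*) :
    MvPolynomial σ K →+ MvPolynomial σ K where
  toFun p := ∑ m ∈ p.support, monomial m ((p.coeff m)′)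
  map_zero' := by simp
  map_add' p q := by
    classical
    have key : ∀ (r : MvPolynomial σ K) (s : Finset (σ →₀ ℕ)), r.support ⊆ s →
        ∑ m ∈ r.support, monomial m ((r.coeff m)′)
          = ∑ m ∈ s, (monomial m ((r.coeff m)′) : MvPolynomial σ K) := by
      intro r s hs
      refine Finset.sum_subset hs fun m _ hm => ?_
      rw [notMem_support_iff.mp hm]
      simp
    rw [key (p + q) (p.support ∪ q.support) support_add,
      key p (p.support ∪ q.support) Finset.subset_union_left,
      key q (p.support ∪ q.support) Finset.subset_union_right, ← Finset.sum_add_distrib]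
    simp

theorem coeffDeriv_monomial {K : Type*} [Field K] [Differential K] {σ : Type*}
    (m : σ →₀ ℕ) (a : K) :
    coeffDeriv σ (monomial m a) = monomial m (a′) := by
  classical
  change ∑ x ∈ (monomial m a).support, monomial x ((coeff x (monomial m a))′) = _
  by_cases ha : a = 0
  · simp [ha]
  · simp [support_monomial, ha]

theorem coeffDeriv_mul {K : Type*} [Field K] [Differential K] {σ : Type*}
    (p q : MvPolynomial σ K) :
    coeffDeriv σ (p * q) = p * coeffDeriv σ q + q * coeffDeriv σ p := by
  induction p using MvPolynomial.induction_on' with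
  | add p₁ p₂ h₁ h₂ => rw [add_mul, map_add, h₁, h₂, map_add]; ring
  | monomial m a =>
    induction q using MvPolynomial.induction_on' with
    | add q₁ q₂ h₁ h₂ => rw [mul_add, map_add, h₁, h₂, map_add]; ring
    | monomial m' b =>
      simp only [coeffDeriv_monomial, monomial_mul, Derivation.leibniz, smul_eq_mul, map_add]
      rw [add_comm m' m]

/-- The derivation `∂` of `K{Y}`: it extends the derivation of `K` and maps the variable
`(y, k)` to `(y, k + 1)`. -/
def D {K : Type*} [Field K] [Differential K] {ι : Type*} :
    Derivation ℤ (DiffPoly K ι) (DiffPoly K ι) :=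
  Derivation.mk'
    (coeffDeriv (ι × ℕ) + (mkDerivation K fun v : ι × ℕ =>
      (X (v.1, v.2 + 1) : DiffPoly K ι)).toLinearMap.toAddMonoidHom).toIntLinearMap
    (by
      intro a b
      simp only [AddMonoidHom.coe_toIntLinearMap, AddMonoidHom.add_apply,
        LinearMap.toAddMonoidHom_coe, Derivation.coeFn_coe,
        Derivation.leibniz, smul_eq_mul, coeffDeriv_mul]
      ring)

theorem D_C {K : Type*} [Field K] [Differential K] {ι : Type*} (a : K) :
    D (C a : DiffPoly K ι) = C (a′) := by
  change coeffDeriv _ (C a) + mkDerivation K _ (C a) = _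
  rw [derivation_C, add_zero]
  exact coeffDeriv_monomial 0 a

theorem D_X {K : Type*} [Field K] [Differential K] {ι : Type*} (v : ι × ℕ) :
    D (X v : DiffPoly K ι) = X (v.1, v.2 + 1) := by
  change coeffDeriv _ (X v) + mkDerivation K _ (X v) = _
  rw [mkDerivation_X]
  have h : coeffDeriv (ι × ℕ) (X v : DiffPoly K ι) = 0 := by
    rw [X, coeffDeriv_monomial]; simp
  rw [h, zero_add]

/-- The differential ideal `[S]` generated by a set `S` of differential polynomials. -/
def diffIdeal {K : Type*} [Field K] [Differential K] {ι : Type*} (S : Set (DiffPoly K ι)) :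
    Ideal (DiffPoly K ι) :=
  Ideal.span {f | ∃ g ∈ S, ∃ k : ℕ, f = D^[k] g}

/-- `ord(f, y)`: the highest order of a derivative of `y` occurring in `f`, and `-1` if no
derivative of `y` occurs in `f`. -/
def ord {K : Type*} [Field K] {ι : Type*} (f : DiffPoly K ι) (y : ι) : ℤ :=
  open scoped Classical in
  (((f.vars.filter fun v => v.1 = y).sup fun v => v.2 + 1 : ℕ) : ℤ) - 1

theorem le_ord {K : Type*} [Field K] {ι : Type*} {f : DiffPoly K ι} {v : ι × ℕ}
    (hv : v ∈ f.vars) : (v.2 : ℤ) ≤ ord f v.1 := by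
  classical
  have h : v.2 + 1 ≤ (f.vars.filter fun w => w.1 = v.1).sup fun w => w.2 + 1 :=
    Finset.le_sup (f := fun w : ι × ℕ => w.2 + 1) (Finset.mem_filter.mpr ⟨hv, rfl⟩)
  have h' : ord f v.1 = (((f.vars.filter fun w => w.1 = v.1).sup fun w => w.2 + 1 : ℕ) : ℤ) - 1 := by
    unfold ord; congr!
  omega

theorem D_mem_supported {K : Type*} [Field K] [Differential K] {ι : Type*} {s t : Set (ι × ℕ)}
    (hst : s ⊆ t) (hs : ∀ v ∈ s, (v.1, v.2 + 1) ∈ t) {f : DiffPoly K ι}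
    (hf : f ∈ supported K s) : D f ∈ supported K t := by
  have hle := supported_mono (R := K) hst
  induction hf using Algebra.adjoin_induction with
  | mem x hx =>
    obtain ⟨v, hv, rfl⟩ := hx
    rw [D_X]
    exact Algebra.subset_adjoin ⟨_, hs v hv, rfl⟩
  | algebraMap r =>
    rw [algebraMap_eq, D_C]
    exact Subalgebra.algebraMap_mem _ _
  | add x y _ _ hx hy => rw [map_add]; exact add_mem hx hy
  | mul x y hx' hy' hx hy =>
    rw [Derivation.leibniz]
    exact add_mem (mul_mem (hle hx') hy) (mul_mem (hle hy') hx)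

/-! ### Rankings, characteristic sets and the differential dimension -/

/-- A ranking on the differential indeterminates `ι`: a total order on their derivatives which is
compatible with `∂`. -/
structure Ranking (ι : Type*) where
  lt : ι × ℕ → ι × ℕ → Prop
  isStrictTotalOrder : IsStrictTotalOrder (ι × ℕ) lt
  lt_deriv : ∀ v : ι × ℕ, lt v (v.1, v.2 + 1)
  deriv_lt_deriv : ∀ v w : ι × ℕ, lt v w → lt (v.1, v.2 + 1) (w.1, w.2 + 1)

/-- `v` is the leader of `f`: the highest derivative occurring in `f`. -/
def IsLeader {K : Type*} [Field K] {ι : Type*} (R : Ranking ι) (f : DiffPoly K ι)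
    (v : ι × ℕ) : Prop :=
  v ∈ f.vars ∧ ∀ w ∈ f.vars, w ≠ v → R.lt w v

/-- `f` has lower rank than `g` (both nonconstant). -/
def RankLT {K : Type*} [Field K] {ι : Type*} (R : Ranking ι) (f g : DiffPoly K ι) : Prop :=
  ∃ v w, IsLeader R f v ∧ IsLeader R g w ∧
    (R.lt v w ∨ (v = w ∧ f.degreeOf v < g.degreeOf w))

/-- `f` and `g` have the same rank (both nonconstant). -/
def RankEq {K : Type*} [Field K] {ι : Type*} (R : Ranking ι) (f g : DiffPoly K ι) : Prop :=
  ∃ v, IsLeader R f v ∧ IsLeader R g v ∧ f.degreeOf v = g.degreeOf v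

/-- `f` is reduced with respect to `g`: no proper derivative of the leader of `g` occurs in `f`,
and the degree of `f` in that leader is lower than the degree of `g` in it. -/
def IsReduced {K : Type*} [Field K] {ι : Type*} (R : Ranking ι) (f g : DiffPoly K ι) : Prop :=
  ∃ v, IsLeader R g v ∧ (∀ k, v.2 < k → (v.1, k) ∉ f.vars) ∧ f.degreeOf v < g.degreeOf v

/-- A chain (autoreduced set) of nonconstant differential polynomials, listed by increasing
rank. -/
def IsChain {K : Type*} [Field K] {ι : Type*} (R : Ranking ι) (l : List (DiffPoly K ι)) : Prop :=
  (∀ f ∈ l, ∃ v, IsLeader R f v) ∧ l.Pairwise (RankLT R) ∧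
    ∀ f ∈ l, ∀ g ∈ l, f ≠ g → IsReduced R f g

/-- The usual comparison of chains: the first difference in rank decides, and a proper
continuation of a chain is lower than the chain. -/
def ChainLT {K : Type*} [Field K] {ι : Type*} (R : Ranking ι) :
    List (DiffPoly K ι) → List (DiffPoly K ι) → Prop
  | [], _ => False
  | _ :: _, [] => True
  | f :: l, g :: l' => RankLT R f g ∨ (RankEq R f g ∧ ChainLT R l l')

/-- A characteristic set of an ideal `I` with respect to `R`: a chain of minimal rank among the
chains contained in `I`. -/
def IsCharacteristicSet {K : Type*} [Field K] {ι : Type*} (R : Ranking ι)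
    (I : Ideal (DiffPoly K ι)) (C : List (DiffPoly K ι)) : Prop :=
  IsChain R C ∧ (∀ f ∈ C, f ∈ I) ∧
    ∀ l, IsChain R l → (∀ f ∈ l, f ∈ I) → ¬ ChainLT R l C

/-- The (differential) dimension of `I` in `n` indeterminates is `d`, that is `d = n - |C|` for
a characteristic set `C` of `I` with respect to some ranking. -/
def HasDiffDim {K : Type*} [Field K] {n : ℕ} (I : Ideal (DiffPoly K (Fin n))) (d : ℕ) : Prop :=
  ∃ (R : Ranking (Fin n)) (C : List (DiffPoly K (Fin n))),
    IsCharacteristicSet R I C ∧ C.length + d = n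

/-! ### Differential operators -/

/-- The ring `K[∂]` of differential operators, realized through its (faithful) action on `K{Y}`:
the ring of additive endomorphisms generated by `∂` and by the multiplications with elements of
`K`. The product is the composition of operators. -/
def DiffOp (K : Type*) [Field K] [Differential K] (ι : Type*) :
    Subring (AddMonoid.End (DiffPoly K ι)) :=
  Subring.closure
    ({T | ∃ c : K, ∀ f, T f = C c * f} ∪ {T | ∀ f, T f = D f})

/-- `L` is a greatest common left divisor of the family `F`. In a noncommutative ring `a ∣ b`
means `∃ c, b = a * c`, that is `a` is a left divisor of `b`. -/
def IsGCLD {R : Type*} [Ring R] {n : ℕ} (L : R) (F : Fin n → R) : Prop :=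
  (∀ i, L ∣ F i) ∧ ∀ M, (∀ i, M ∣ F i) → M ∣ L

/-! ### Gröbner bases -/

/-- `G` is the reduced Gröbner basis of the ideal `I` with respect to the monomial order `m`. The
ideal is given by the set of its elements, because it may be an ideal of a ring of polynomials in
only some of the variables. -/
structure IsReducedGroebnerBasis {K : Type*} [Field K] {σ : Type*} (m : MonomialOrder σ)
    (I G : Set (MvPolynomial σ K)) : Prop where
  subset : G ⊆ I
  exists_degree_le : ∀ f ∈ I, f ≠ 0 → ∃ g ∈ G, m.degree g ≤ m.degree f
  monic : ∀ g ∈ G, m.Monic g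
  reduced : ∀ g ∈ G, ∀ h ∈ G, h ≠ g → ∀ a ∈ g.support, ¬ m.degree h ≤ a

/-- The position in the ranking that eliminates `U` with respect to `X`. All the derivatives
of the `x`'s are below all the derivatives of the `u`'s; the ranking on `X` is
`x_n < ∂ x_n < ∂² x_n < ⋯ < x_{n-1} < ∂ x_{n-1} < ⋯`, and the ranking on `U` is the orderly one,
`u_1 < ⋯ < u_{n-1} < ∂ u_1 < ⋯ < ∂ u_{n-1} < ∂² u_1 < ⋯`. -/
def rankStar (n : ℕ) : (Fin n ⊕ Fin (n - 1)) × ℕ → ((Fin n)ᵒᵈ ×ₗ ℕ) ⊕ₗ (ℕ ×ₗ Fin (n - 1))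
  | (Sum.inl i, k) => Sum.inlₗ (toLex (OrderDual.toDual i, k))
  | (Sum.inr j, k) => Sum.inrₗ (toLex (k, j))

theorem rankStar_injective (n : ℕ) : Function.Injective (rankStar n) := by
  rintro ⟨i | i, k⟩ ⟨j | j, l⟩ h
  · have h' := toLex.injective (Sum.inl.inj (toLex.injective h))
    simp only [Prod.mk.injEq, EmbeddingLike.apply_eq_iff_eq] at h'
    rw [h'.1, h'.2]
  · exact absurd (toLex.injective h) (by simp)
  · exact absurd (toLex.injective h) (by simp)
  · have h' := toLex.injective (Sum.inr.inj (toLex.injective h))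
    simp only [Prod.mk.injEq] at h'
    rw [h'.1, h'.2]

/-- The lexicographic monomial order on `K{X ∪ U}` induced by `rankStar`. In
`MonomialOrder.lex` a smaller index means a higher variable, hence the order dual. -/
def lexStar (n : ℕ) : MonomialOrder ((Fin n ⊕ Fin (n - 1)) × ℕ) :=
  letI o : LinearOrder ((Fin n ⊕ Fin (n - 1)) × ℕ) :=
    LinearOrder.lift' (fun v => OrderDual.toDual (rankStar n v))
      (OrderDual.toDual.injective.comp (rankStar_injective n))
  haveI : @WellFoundedGT _ o.toLT :=
    ⟨InvImage.wf (rankStar n) (Sum.lex_wf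
      (wellFounded_lt (α := (Fin n)ᵒᵈ ×ₗ ℕ)) (wellFounded_lt (α := ℕ ×ₗ Fin (n - 1))))⟩
  @MonomialOrder.lex _ o this

/-! ### Systems of linear differential polynomial parametric equations -/

/-- A system `x_i = P_i(U)`, `i = 1, …, n`, of linear differential polynomial parametric equations
in the `n - 1` differential parameters `u_j`: the `P_i` have degree at most one, not all of them
are in `K`, and every parameter occurs in the system. -/
structure System (K : Type*) [Field K] (n : ℕ) where
  P : Fin n → DiffPoly K (Fin (n - 1))
  totalDegree_le : ∀ i, (P i).totalDegree ≤ 1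
  exists_not_const : ∃ i, ∀ c : K, P i ≠ C c
  exists_ord_nonneg : ∀ j, ∃ i, 0 ≤ ord (P i) j

namespace System

variable {K : Type*} [Field K] {n : ℕ} (S : System K n)

/-- The inclusion `K{X} ⊆ K{X ∪ U}`. -/
def inX : DiffPoly K (Fin n) →ₐ[K] DiffPoly K (Fin n ⊕ Fin (n - 1)) :=
  rename fun v => (Sum.inl v.1, v.2)

/-- The inclusion `K{U} ⊆ K{X ∪ U}`. -/
def inU : DiffPoly K (Fin (n - 1)) →ₐ[K] DiffPoly K (Fin n ⊕ Fin (n - 1)) :=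
  rename fun v => (Sum.inr v.1, v.2)

/-- `F_i(X, U) = x_i - P_i(U)`. -/
def F (i : Fin n) : DiffPoly K (Fin n ⊕ Fin (n - 1)) :=
  X (Sum.inl i, 0) - inU (S.P i)

/-- `a_i`, the constant term of `P_i`. -/
def a (i : Fin n) : K := constantCoeff (S.P i)

/-- `o_i`, the order of `F_i` as a differential polynomial in `U` (it is `0` if `P_i ∈ K`). -/
def o (i : Fin n) : ℕ := Finset.univ.sup fun j => (ord (S.F i) (Sum.inr j)).toNat

/-- `N = o_1 + ⋯ + o_n`. -/
def N : ℕ := ∑ i, S.o i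

/-- `γ_j = min_i (o_i - ord(F_i, u_j))`. -/
def gammaU (j : Fin (n - 1)) : ℤ := ⨅ i, ((S.o i : ℤ) - ord (S.F i) (Sum.inr j))

/-- The completeness index `γ = γ_1 + ⋯ + γ_{n-1}`. -/
def gamma : ℤ := ∑ j, S.gammaU j

/-- The set `𝒳` of the derivatives `x_{ik}` with `k ≤ N - o_i - γ`. -/
def varsX : Set (Fin n × ℕ) := {v | (v.2 : ℤ) ≤ S.N - S.o v.1 - S.gamma}

/-- The set `𝒱` of the derivatives `u_{jk}` with `k ≤ N - γ_j - γ`. -/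
def varsU : Set (Fin (n - 1) × ℕ) := {v | (v.2 : ℤ) ≤ S.N - S.gammaU v.1 - S.gamma}

/-- The set `𝒳 ∪ 𝒱`, as a set of variables of `K{X ∪ U}`. -/
def varsXU : Set ((Fin n ⊕ Fin (n - 1)) × ℕ) :=
  (fun v => (Sum.inl v.1, v.2)) '' S.varsX ∪ (fun v => (Sum.inr v.1, v.2)) '' S.varsU

variable [Differential K]

/-- The implicit ideal `ID = {f ∈ K{X} | f(P_1(U), …, P_n(U)) = 0}`. -/
def ID : Ideal (DiffPoly K (Fin n)) :=
  RingHom.ker (aeval (R := K) fun v : Fin n × ℕ => D^[v.2] (S.P v.1))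

/-- The set `PS` of the derivatives `∂^k F_i` with `0 ≤ k ≤ N - o_i - γ`. -/
def PS : Set (DiffPoly K (Fin n ⊕ Fin (n - 1))) :=
  {f | ∃ (i : Fin n) (k : ℕ), (k : ℤ) ≤ S.N - S.o i - S.gamma ∧ f = D^[k] (S.F i)}

/-- `PS` is contained in `K[𝒳][𝒱]`. -/
theorem PS_subset : S.PS ⊆ supported K S.varsXU := by
  rintro _ ⟨i, k, hk, rfl⟩
  have key : ∀ m : ℕ, D^[m] (S.F i) ∈ supported K
      {v : (Fin n ⊕ Fin (n - 1)) × ℕ | ∃ w ∈ (S.F i).vars, w.1 = v.1 ∧ v.2 ≤ w.2 + m} := by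
    intro m
    induction m with
    | zero =>
      rw [Function.iterate_zero, id, mem_supported]
      exact fun v hv => ⟨v, hv, rfl, le_rfl⟩
    | succ m ih =>
      rw [Function.iterate_succ_apply']
      refine D_mem_supported ?_ ?_ ih
      · rintro v ⟨w, hw, h1, h2⟩
        exact ⟨w, hw, h1, by omega⟩
      · rintro v ⟨w, hw, h1, h2⟩
        exact ⟨w, hw, h1, by simp only; omega⟩
  refine supported_mono (R := K) ?_ (key k)
  rintro ⟨y, l⟩ ⟨⟨y', l'⟩, hw, h1, h2⟩
  simp only at h1 h2
  subst h1
  have hle := le_ord hw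
  simp only at hle
  classical
  have hsub := vars_sub_subset (X (Sum.inl i, 0)) (q := inU (S.P i)) hw
  rcases y' with i' | j
  · left
    have : (i', l') = (i, 0) := by
      rw [Finset.mem_union] at hsub
      rcases hsub with h | h
      · rw [vars_X, Finset.mem_singleton] at h
        simpa using h
      · obtain ⟨u, -, hu⟩ := Finset.mem_image.mp (vars_rename _ _ h)
        simp at hu
    simp only [Prod.mk.injEq] at this
    obtain ⟨rfl, rfl⟩ := this
    exact ⟨(i', l), by simp only [varsX, Set.mem_ofPred_eq]; omega, rfl⟩
  · right
    have hg : S.gammaU j ≤ (S.o i : ℤ) - ord (S.F i) (Sum.inr j) :=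
      ciInf_le (Set.finite_range _).bddBelow i
    exact ⟨(j, l), by simp only [varsU, Set.mem_ofPred_eq]; omega, rfl⟩

/-- The ideal `(PS)` generated by `PS` in the polynomial ring `K[𝒳][𝒱]`, as a
`K[𝒳][𝒱]`-submodule of `K{X ∪ U}`. -/
def idealPS : Submodule (supported K S.varsXU) (DiffPoly K (Fin n ⊕ Fin (n - 1))) :=
  Submodule.span _ S.PS

/-- `G` is the Gröbner basis associated to the system: the reduced Gröbner basis of `(PS)` with
respect to the lexicographic order induced by the ranking that eliminates `U`. -/
def IsAssociatedGroebnerBasis (G : Set (DiffPoly K (Fin n ⊕ Fin (n - 1)))) : Prop :=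
  IsReducedGroebnerBasis (lexStar n) (S.idealPS : Set _) G

/-- `𝒢₀ = G ∩ K{X}`. -/
def partX (G : Set (DiffPoly K (Fin n ⊕ Fin (n - 1)))) : Set (DiffPoly K (Fin n)) :=
  {f | inX f ∈ G}

/-- The ideal `(𝒢₀)` generated by `𝒢₀` in the polynomial ring `K[𝒳]`, as a `K[𝒳]`-submodule
of `K{X}`. -/
def idealPartX (G : Set (DiffPoly K (Fin n ⊕ Fin (n - 1)))) :
    Submodule (supported K S.varsX) (DiffPoly K (Fin n)) :=
  Submodule.span _ (partX G)

/-- `c` is the co-order of `B` in `(PS)`: the highest `c` such that `∂^c B ∈ (PS)`. -/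
def IsCoOrder (B : DiffPoly K (Fin n)) (c : ℕ) : Prop :=
  IsGreatest {k : ℕ | inX (D^[k] B) ∈ S.idealPS} c

/-- `B` is `ID`-primitive: `B = ∑ ℱ_i(x_i - a_i)` with operators `ℱ_i ∈ K[∂]`, whose greatest
common left divisor (the `ID`-content of `B`) is in `K`. -/
def IsIDPrimitive (B : DiffPoly K (Fin n)) : Prop :=
  ∃ T : Fin n → DiffOp K (Fin n), B = ∑ i, (T i).1 (X (i, 0) - C (S.a i)) ∧
    ∃ L : DiffOp K (Fin n), IsGCLD L T ∧ ∃ c : K, ∀ f, L.1 f = C c * f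

end System

end

end LinearDPPE

/-! Everything reduces to linear algebra over `K`. Up to constants, the substitution `x_i ↦ P_i(U)`
is a homomorphism `formMap` of left `K[∂]`-modules from the linear forms in the `x_ik` to those in
the `u_jk`. Its kernel is the linear part of `ID`, and affine forms with independent linear parts
are algebraically independent (`eq_zero_of_mem_ID`).

Dimension `n - 1` means that a characteristic set is a single `f`. The variables of `f` carry a
nonzero linear relation `α`, of the same rank as `f` by minimality. A kernel element not reducing to
zero modulo `α` would prolong `α` to a lower chain, so the kernel is `K[∂]α` (`exists_isGenerator`).
This property of `α` no longer refers to the ranking, so the elimination ranking may be used from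
there on.

Counting dimensions of large boxes of derivatives shows that `α` involves only variables of `𝒳`
(`IsGenerator.mem_varsX`). Since `x_ik = ∂^k F_i + ∂^k P_i`, a kernel form lies in `(PS)` exactly
when it is supported in `𝒳`; so the derivatives of `α` in `(PS)` are those of order `0, …, c`, with
`c` the co-order.

Rewriting the leaders of these derivatives by smaller variables sends every element of `ID ∩ K[𝒳]`
to zero, so its leading monomial is divisible by one of the `c + 1` leaders
(`IsGenerator.exists_degree_ne_zero`). Hence the leading monomials of `𝒢₀` are exactly these
leaders, and the smallest basis element is a scalar multiple of `α`. The same rewriting with all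
variables allowed gives `ID = [α]`.

Finally, `K[∂]` has no zero divisors and `formMap` is `K[∂]`-linear: a common left divisor of the
components of `α` is invertible, and a primitive `tα` has `t ∈ K`, so it is again a generator. -/

namespace LinearDPPE

noncomputable section

open scoped MonomialOrder

/-! ### Linear forms -/

section LinearForms

variable {K : Type*} [Field K] {σ : Type*}

/-- The linear form with coefficients `b`. -/
def lin : (σ →₀ K) →ₗ[K] MvPolynomial σ K := Finsupp.linearCombination K X

theorem lin_single (v : σ) (c : K) : lin (Finsupp.single v c) = c • (X v : MvPolynomial σ K) :=
  Finsupp.linearCombination_single K c v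

theorem coeff_lin (b : σ →₀ K) (v : σ) : coeff (Finsupp.single v 1) (lin b) = b v := by
  classical
  induction b using Finsupp.induction_linear with
  | zero => simp
  | add f g hf hg => rw [map_add, coeff_add, hf, hg, Finsupp.add_apply]
  | single w c =>
    rw [lin_single, coeff_smul, coeff_X, Finsupp.single_apply]
    simp [Finsupp.single_left_inj]

theorem constantCoeff_lin (b : σ →₀ K) : constantCoeff (lin b) = 0 := by
  induction b using Finsupp.induction_linear with
  | zero => simp
  | add f g hf hg => rw [map_add, map_add, hf, hg, add_zero]
  | single w c => rw [lin_single, MvPolynomial.smul_eq_C_mul]; simp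

theorem coeff_lin_add_C (b : σ →₀ K) (c : K) (v : σ) :
    coeff (Finsupp.single v 1) (lin b + C c) = b v := by
  classical
  rw [coeff_add, coeff_lin, coeff_C, if_neg (by simp [eq_comm]), add_zero]

theorem lin_injective : Function.Injective (lin : (σ →₀ K) →ₗ[K] MvPolynomial σ K) := by
  intro b b' h
  ext v
  rw [← coeff_lin, h, coeff_lin]

theorem exists_eq_lin_add_C {p : MvPolynomial σ K} (h : p.totalDegree ≤ 1) :
    ∃ b c, p = lin b + C c := by
  classical
  rw [p.as_sum]
  refine Finset.sum_induction _ (fun q => ∃ b c, q = lin b + C c) ?_ ⟨0, 0, by simp⟩ ?_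
  · rintro _ _ ⟨b, c, rfl⟩ ⟨b', c', rfl⟩
    exact ⟨b + b', c + c', by simp only [map_add]; ring⟩
  · intro m hm
    have h1 : m.degree ≤ 1 := (le_totalDegree hm).trans h
    rcases Nat.le_one_iff_eq_zero_or_eq_one.mp h1 with h0 | h0
    · refine ⟨0, coeff m p, ?_⟩
      rw [(Finsupp.degree_eq_zero_iff m).mp h0]
      simp
    · have hm0 : m ≠ 0 := by rintro rfl; simp at h0
      obtain ⟨v, hv⟩ := Finsupp.ne_iff.mp hm0
      have hle : Finsupp.single v 1 ≤ m :=
        Finsupp.single_le_iff.mpr (Nat.one_le_iff_ne_zero.mpr hv)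
      have hdeg : (Finsupp.single v 1 + (m - Finsupp.single v 1)).degree = 1 := by
        rw [add_tsub_cancel_of_le hle, h0]
      rw [map_add, Finsupp.degree_single, Nat.add_eq_left, Finsupp.degree_eq_zero_iff] at hdeg
      obtain rfl : m = Finsupp.single v 1 := by
        rw [← add_tsub_cancel_of_le hle, hdeg, add_zero]
      refine ⟨Finsupp.single v (coeff (Finsupp.single v 1) p), 0, ?_⟩
      rw [lin_single, map_zero, add_zero, X, smul_monomial, smul_eq_mul, mul_one]

theorem mem_support_lin_add_C {b : σ →₀ K} {c : K} {m : σ →₀ ℕ} (h : m ∈ (lin b + C c).support) :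
    m = 0 ∨ ∃ v, b v ≠ 0 ∧ m = Finsupp.single v 1 := by
  classical
  rcases Finset.mem_union.mp (support_add h) with h | h
  · right
    rw [lin, Finsupp.linearCombination_apply, Finsupp.sum] at h
    obtain ⟨v, hv, hm⟩ := Finset.mem_biUnion.mp (support_sum h)
    have := support_smul hm
    rw [support_X, Finset.mem_singleton] at this
    exact ⟨v, Finsupp.mem_support_iff.mp hv, this⟩
  · left
    by_contra h0
    rw [mem_support_iff, coeff_C, if_neg (Ne.symm h0)] at h
    exact h rfl

theorem mem_vars_lin_add_C {b : σ →₀ K} {c : K} {v : σ} :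
    v ∈ (lin b + C c).vars ↔ b v ≠ 0 := by
  classical
  rw [mem_vars_iff_mem_support]
  constructor
  · rintro ⟨m, hm, hv⟩
    rcases mem_support_lin_add_C hm with rfl | ⟨w, hw, rfl⟩
    · simp at hv
    · rwa [Finset.mem_singleton.mp (Finsupp.support_single_subset hv)]
  · intro h
    exact ⟨Finsupp.single v 1, by rwa [mem_support_iff, coeff_lin_add_C], by simp⟩

theorem totalDegree_lin_add_C_le (b : σ →₀ K) (c : K) : (lin b + C c).totalDegree ≤ 1 := by
  refine Finset.sup_le fun m hm => ?_
  rcases mem_support_lin_add_C hm with rfl | ⟨w, hw, rfl⟩ <;> simp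

theorem lin_add_C_mem_supported {b : σ →₀ K} {c : K} {s : Set σ} :
    lin b + C c ∈ supported K s ↔ b ∈ Finsupp.supported K K s := by
  rw [mem_supported, Finsupp.mem_supported]
  exact forall_congr' fun v => by
    rw [Finset.mem_coe, mem_vars_lin_add_C, Finset.mem_coe, Finsupp.mem_support_iff]

end LinearForms

/-! ### Operators acting on a differential module -/

section Operators

variable {K : Type*} [Field K] {M M' : Type*} [AddCommGroup M] [Module K M]
  [AddCommGroup M'] [Module K M']

/-- The value at `m` of the operator `∑ t_k d^k`. -/
def op (d : M → M) (m : M) : (ℕ →₀ K) →ₗ[K] M := Finsupp.linearCombination K fun k => d^[k] m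

theorem op_single (d : M → M) (m : M) (k : ℕ) (c : K) :
    op d m (Finsupp.single k c) = c • d^[k] m :=
  Finsupp.linearCombination_single K c k

theorem op_zero {d : M → M} (h : d 0 = 0) (t : ℕ →₀ K) : op d 0 t = 0 := by
  have h' : (fun k : ℕ => d^[k] 0) = 0 := funext fun k => Function.iterate_fixed h k
  rw [op, h', Finsupp.linearCombination_zero, LinearMap.zero_apply]

theorem map_op {d : M → M} {d' : M' → M'} (f : M →ₗ[K] M') (h : ∀ m, f (d m) = d' (f m)) (m : M)
    (t : ℕ →₀ K) : f (op d m t) = op d' (f m) t := by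
  have h' : ∀ k m, f (d^[k] m) = d'^[k] (f m) := fun k =>
    Function.Semiconj.iterate_right (f := f) (ga := d) (gb := d') h k
  induction t using Finsupp.induction_linear with
  | zero => simp
  | add s t hs ht => simp only [map_add, hs, ht]
  | single k c => rw [op_single, op_single, map_smul, h']

variable [Differential K]

/-- The coefficients of `d ∘ (∑ t_k d^k)`. -/
def opDeriv : (ℕ →₀ K) →+ (ℕ →₀ K) :=
  Finsupp.mapRange.addMonoidHom (Differential.deriv : Derivation ℤ K K).toLinearMap.toAddMonoidHom +
    Finsupp.mapDomain.addMonoidHom Nat.succ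

theorem opDeriv_single (k : ℕ) (c : K) :
    opDeriv (Finsupp.single k c) = Finsupp.single k (c′) + Finsupp.single (k + 1) c := by
  simp [opDeriv]

theorem map_op_eq_op_opDeriv {d : M → M} (ha : ∀ x y, d (x + y) = d x + d y)
    (hd : ∀ (c : K) m, d (c • m) = c′ • m + c • d m) (m : M)
    (t : ℕ →₀ K) : d (op d m t) = op d m (opDeriv t) := by
  induction t using Finsupp.induction_linear with
  | zero => simpa using hd 0 0
  | add s t hs ht => simp only [map_add, ha, hs, ht]
  | single k c =>
    rw [opDeriv_single, map_add, op_single, op_single, op_single, hd, Function.iterate_succ_apply']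

/-- With `opDeriv` as left multiplication by `∂`, `ℕ →₀ K` is `K[∂]` as a left module over itself,
and `op opDeriv t s` is the product `s ∘ t`. Evaluation at `m` commutes with the derivations, hence
with all operators. -/
theorem op_op {d : M → M} (ha : ∀ x y, d (x + y) = d x + d y)
    (hd : ∀ (c : K) m, d (c • m) = c′ • m + c • d m) (m : M)
    (s t : ℕ →₀ K) : op d (op d m t) s = op d m (op opDeriv t s) :=
  by
  have h := map_op (d := ⇑(opDeriv (K := K))) (d' := d) (op d m)
    (fun t => (map_op_eq_op_opDeriv ha hd m t).symm) t s
  exact h.symm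

end Operators

/-! ### The derivation on the coefficients of linear forms -/

section ShiftDeriv

theorem exists_top {M : Type*} [Zero M] {b : ℕ → M} (hb : b.support.Finite) (h : ∃ k, b k ≠ 0) :
    ∃ k, b k ≠ 0 ∧ ∀ l, k < l → b l = 0 := by
  obtain ⟨k, hk, hmax⟩ := Set.exists_max_image b.support id hb h
  exact ⟨k, hk, fun l hl => by
    by_contra hne
    exact absurd (hmax l hne) (not_le.mpr hl)⟩

theorem exists_top_finsupp {M : Type*} [Zero M] {t : ℕ →₀ M} (h : t ≠ 0) :
    ∃ k, t k ≠ 0 ∧ ∀ l, k < l → t l = 0 :=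
  exists_top t.hasFiniteSupport (by simpa using Finsupp.ne_iff.mp h)

theorem exists_top_row {M : Type*} [Zero M] {ι : Type*} {b : ι × ℕ →₀ M} {i : ι} {k : ℕ}
    (h : b (i, k) ≠ 0) : ∃ k, b (i, k) ≠ 0 ∧ ∀ l, k < l → b (i, l) = 0 :=
  exists_top (b := fun k => b (i, k))
    (b.hasFiniteSupport.preimage (Prod.mk_right_injective i).injOn) ⟨k, h⟩

variable {K : Type*} [Field K] [Differential K] {ι : Type*}

/-- The derivation `∂` on the coefficients of linear forms. -/
def shiftDeriv : (ι × ℕ →₀ K) →+ (ι × ℕ →₀ K) :=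
  Finsupp.mapRange.addMonoidHom (Differential.deriv : Derivation ℤ K K).toLinearMap.toAddMonoidHom +
    Finsupp.mapDomain.addMonoidHom fun v => (v.1, v.2 + 1)

theorem shiftDeriv_single (v : ι × ℕ) (c : K) :
    shiftDeriv (Finsupp.single v c) =
      Finsupp.single v (c′) + Finsupp.single (v.1, v.2 + 1) c := by
  simp [shiftDeriv]

theorem shiftDeriv_smul (c : K) (b : ι × ℕ →₀ K) :
    shiftDeriv (c • b) = c′ • b + c • shiftDeriv b := by
  induction b using Finsupp.induction_linear with
  | zero => simp
  | add s t hs ht => simp only [smul_add, map_add, hs, ht]; abel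
  | single k a =>
    simp only [shiftDeriv_single, Finsupp.smul_single, smul_eq_mul, Derivation.leibniz, smul_add,
      Finsupp.single_add]
    rw [mul_comm a]; abel

theorem shiftDeriv_apply_succ (b : ι × ℕ →₀ K) (i : ι) (k : ℕ) :
    shiftDeriv b (i, k + 1) = (b (i, k + 1))′ + b (i, k) := by
  classical
  induction b using Finsupp.induction_linear with
  | zero => simp
  | add s t hs ht => simp only [map_add, Finsupp.add_apply, hs, ht]; ring
  | single v a =>
    obtain ⟨j, l⟩ := v
    simp only [shiftDeriv_single, Finsupp.add_apply, Finsupp.single_apply, Prod.mk.injEq,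
      add_left_inj]
    split_ifs <;> simp

theorem iterate_shiftDeriv_top {b : ι × ℕ →₀ K} {i : ι} {k : ℕ} (h : ∀ l, k < l → b (i, l) = 0)
    (j : ℕ) : (shiftDeriv^[j] b) (i, k + j) = b (i, k) ∧
      ∀ l, k + j < l → (shiftDeriv^[j] b) (i, l) = 0 := by
  induction j with
  | zero => exact ⟨rfl, h⟩
  | succ j ih =>
    rw [Function.iterate_succ_apply']
    refine ⟨?_, fun l hl => ?_⟩
    · rw [← add_assoc, shiftDeriv_apply_succ, ih.1, ih.2 _ (Nat.lt_succ_self _)]; simp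
    · obtain ⟨l, rfl⟩ := Nat.exists_eq_succ_of_ne_zero (by omega : l ≠ 0)
      rw [Nat.succ_eq_add_one, shiftDeriv_apply_succ, ih.2 _ (by omega), ih.2 _ (by omega)]; simp

/-- Differentiation acts row by row and raises the order of a row by at most one. -/
theorem exists_of_iterate_shiftDeriv_ne_zero {b : ι × ℕ →₀ K} {j : ℕ} {v : ι × ℕ}
    (h : (shiftDeriv^[j] b) v ≠ 0) : ∃ k, b (v.1, k) ≠ 0 ∧ v.2 ≤ k + j := by
  by_contra! hcon
  obtain ⟨i, l⟩ := v
  by_cases hb : ∃ k, b (i, k) ≠ 0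
  · obtain ⟨k, hk⟩ := hb
    obtain ⟨k, hk, htop⟩ := exists_top_row hk
    exact h ((iterate_shiftDeriv_top htop j).2 _ (hcon k hk))
  · push Not at hb
    rcases lt_or_ge j l with hl | hl
    · exact h ((iterate_shiftDeriv_top (k := 0) (fun l _ => hb l) j).2 _ (by omega))
    -- The bound on the top order says nothing about orders `l ≤ j`; here both summands of
    -- `shiftDeriv` are seen to preserve a zero row.
    · clear hcon
      have : ∀ j l, (shiftDeriv^[j] b) (i, l) = 0 := by
        intro j
        have hmap : ∀ c : ι × ℕ →₀ K, (∀ l, c (i, l) = 0) → ∀ l, shiftDeriv c (i, l) = 0 := by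
          intro c hc l
          rw [shiftDeriv, AddMonoidHom.add_apply, Finsupp.add_apply]
          have h1 : Finsupp.mapDomain (fun v : ι × ℕ => (v.1, v.2 + 1)) c (i, l) = 0 := by
            rcases l with _ | l
            · refine Finsupp.mapDomain_of_notMem_range c _ ?_
              rintro ⟨w, hw⟩
              simp at hw
            · rw [show (i, l + 1) = (fun v : ι × ℕ => (v.1, v.2 + 1)) (i, l) from rfl,
                Finsupp.mapDomain_apply, hc]
              rintro ⟨a, b⟩ ⟨a', b'⟩ hab
              simpa using hab
          simpa [hc] using h1
        induction j with
        | zero => exact hb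
        | succ j ih =>
          rw [Function.iterate_succ_apply']
          exact hmap _ ih
      exact h (this j l)

/-- Derivatives of coefficients appear only in lower order, so leading coefficients multiply and
orders add. This replaces the absence of zero divisors in `K[∂]`. -/
theorem op_shiftDeriv_top {b : ι × ℕ →₀ K} {i : ι} {k : ℕ} (h : ∀ l, k < l → b (i, l) = 0)
    {t : ℕ →₀ K} {d : ℕ} (ht : ∀ l, d < l → t l = 0) :
    op shiftDeriv b t (i, k + d) = t d * b (i, k) ∧
      ∀ l, k + d < l → op shiftDeriv b t (i, l) = 0 := by
  have hsum : ∀ l, op shiftDeriv b t (i, l) =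
      ∑ j ∈ t.support, t j * (shiftDeriv^[j] b) (i, l) := by
    intro l
    rw [op, Finsupp.linearCombination_apply, Finsupp.sum, Finsupp.finsetSum_apply]
    rfl
  have hle : ∀ j ∈ t.support, j ≤ d := fun j hj => by
    by_contra hlt
    exact Finsupp.mem_support_iff.mp hj (ht j (not_le.mp hlt))
  refine ⟨?_, fun l hl => ?_⟩
  · rw [hsum, Finset.sum_eq_single d, (iterate_shiftDeriv_top h d).1]
    · intro j hj hjd
      have := hle j hj
      rw [(iterate_shiftDeriv_top h j).2 _ (by omega), mul_zero]
    · intro hd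
      rw [Finsupp.notMem_support_iff.mp hd, zero_mul]
  · rw [hsum]
    refine Finset.sum_eq_zero fun j hj => ?_
    have := hle j hj
    rw [(iterate_shiftDeriv_top h j).2 _ (by omega), mul_zero]

theorem op_shiftDeriv_injective {b : ι × ℕ →₀ K} (hb : b ≠ 0) :
    Function.Injective (op (K := K) shiftDeriv b) := by
  refine (injective_iff_map_eq_zero _).mpr fun t ht => ?_
  by_contra hne
  obtain ⟨⟨i, k⟩, hk⟩ := Finsupp.ne_iff.mp hb
  obtain ⟨k, hk, htop⟩ := exists_top_row hk
  obtain ⟨d, hd, hdtop⟩ := exists_top_finsupp hne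
  have := (op_shiftDeriv_top htop hdtop).1
  rw [ht] at this
  exact mul_ne_zero hd hk this.symm

theorem D_smul (c : K) (p : DiffPoly K ι) : D (c • p) = c′ • p + c • D p := by
  rw [MvPolynomial.smul_eq_C_mul, Derivation.leibniz, D_C, MvPolynomial.smul_eq_C_mul,
    MvPolynomial.smul_eq_C_mul, smul_eq_mul, smul_eq_mul]
  ring

theorem D_lin (b : ι × ℕ →₀ K) : D (lin b) = lin (shiftDeriv b) := by
  induction b using Finsupp.induction_linear with
  | zero => simp
  | add s t hs ht => simp only [map_add, hs, ht]
  | single v a => rw [shiftDeriv_single, map_add, lin_single, lin_single, lin_single, D_smul, D_X]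

theorem iterate_D_lin_add_C (b : ι × ℕ →₀ K) (c : K) (k : ℕ) :
    D^[k] (lin b + C c) = lin (shiftDeriv^[k] b) + C ((fun a : K => a′)^[k] c) := by
  induction k with
  | zero => rfl
  | succ k ih => simp only [Function.iterate_succ_apply', ih, map_add, D_lin, D_C]

end ShiftDeriv

theorem linearCombination_shiftDeriv {K : Type*} [Field K] [Differential K] {ι M : Type*}
    [AddCommGroup M] [Module K M] {d : M → M} (ha : ∀ x y, d (x + y) = d x + d y)
    (hd : ∀ (c : K) m, d (c • m) = c′ • m + c • d m)
    (m : ι → M) (b : ι × ℕ →₀ K) :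
    Finsupp.linearCombination K (fun v : ι × ℕ => d^[v.2] (m v.1)) (shiftDeriv b) =
      d (Finsupp.linearCombination K (fun v : ι × ℕ => d^[v.2] (m v.1)) b) := by
  induction b using Finsupp.induction_linear with
  | zero => simpa using (hd 0 0).symm
  | add s t hs ht => simp only [map_add, ha, hs, ht]
  | single v a =>
    rw [shiftDeriv_single, map_add]
    simp only [Finsupp.linearCombination_single]
    rw [hd, Function.iterate_succ_apply']

/-! ### The substitution and its linear part -/

namespace System

variable {K : Type*} [Field K] {n : ℕ} (S : System K n)

/-- The coefficients of the linear part of `P_i`. -/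
def form (i : Fin n) : Fin (n - 1) × ℕ →₀ K :=
  (exists_eq_lin_add_C (S.totalDegree_le i)).choose

theorem P_eq (i : Fin n) : S.P i = lin (S.form i) + C (S.a i) := by
  obtain ⟨c, hc⟩ := (exists_eq_lin_add_C (S.totalDegree_le i)).choose_spec
  have : S.a i = c := by rw [a, hc, map_add, constantCoeff_lin, constantCoeff_C, zero_add]
  rw [this]
  exact hc

variable [Differential K]

/-- The substitution `x_i ↦ P_i(U)`. -/
def eval : DiffPoly K (Fin n) →ₐ[K] DiffPoly K (Fin (n - 1)) :=
  aeval fun v : Fin n × ℕ => D^[v.2] (S.P v.1)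

theorem mem_ID {f : DiffPoly K (Fin n)} : f ∈ S.ID ↔ S.eval f = 0 := Iff.rfl

theorem eval_X (v : Fin n × ℕ) : S.eval (X v) = D^[v.2] (S.P v.1) := aeval_X _ v

theorem eval_C (c : K) : S.eval (C c) = C c := aeval_C _ c

theorem eval_D (f : DiffPoly K (Fin n)) : S.eval (D f) = D (S.eval f) := by
  induction f using MvPolynomial.induction_on with
  | C c => rw [D_C, eval_C, eval_C, D_C]
  | add p q hp hq => simp only [map_add, hp, hq]
  | mul_X p v hp =>
    simp only [Derivation.leibniz, map_mul, map_add, smul_eq_mul, hp, D_X, eval_X,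
      Function.iterate_succ_apply']

theorem eval_iterate_D (f : DiffPoly K (Fin n)) (k : ℕ) :
    S.eval (D^[k] f) = D^[k] (S.eval f) :=
  Function.Semiconj.iterate_right (f := S.eval) (ga := D) (gb := D) S.eval_D k f

theorem iterate_D_mem_ID {f : DiffPoly K (Fin n)} (hf : f ∈ S.ID) (k : ℕ) : D^[k] f ∈ S.ID := by
  rw [mem_ID] at *
  rw [eval_iterate_D, hf]
  exact Function.iterate_fixed (map_zero _) k

/-- The linear part of the substitution `x_i ↦ P_i(U)`. -/
def formMap : (Fin n × ℕ →₀ K) →ₗ[K] (Fin (n - 1) × ℕ →₀ K) :=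
  Finsupp.linearCombination K fun v => shiftDeriv^[v.2] (S.form v.1)

theorem formMap_shiftDeriv (b : Fin n × ℕ →₀ K) :
    S.formMap (shiftDeriv b) = shiftDeriv (S.formMap b) :=
  linearCombination_shiftDeriv (map_add _) shiftDeriv_smul S.form b

theorem formMap_op (b : Fin n × ℕ →₀ K) (t : ℕ →₀ K) :
    S.formMap (op shiftDeriv b t) = op shiftDeriv (S.formMap b) t :=
  map_op S.formMap S.formMap_shiftDeriv b t

/-- The linear form in the derivatives of the `x_i - a_i` with coefficients `b`. -/
def aff : (Fin n × ℕ →₀ K) →ₗ[K] DiffPoly K (Fin n) :=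
  Finsupp.linearCombination K fun v => D^[v.2] (X (v.1, 0) - C (S.a v.1))

theorem D_aff (b : Fin n × ℕ →₀ K) : S.aff (shiftDeriv b) = D (S.aff b) :=
  linearCombination_shiftDeriv (map_add _) D_smul
    (fun i => X (i, 0) - C (S.a i)) b

theorem iterate_D_aff (b : Fin n × ℕ →₀ K) (k : ℕ) :
    D^[k] (S.aff b) = S.aff (shiftDeriv^[k] b) :=
  (Function.Semiconj.iterate_right (f := S.aff) (ga := shiftDeriv) (gb := D) S.D_aff k b).symm

theorem aff_op (b : Fin n × ℕ →₀ K) (t : ℕ →₀ K) :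
    S.aff (op shiftDeriv b t) = op D (S.aff b) t :=
  map_op S.aff S.D_aff b t

theorem iterate_D_X_sub_C {ι : Type*} (i : ι) (c : K) (k : ℕ) :
    D^[k] (X (i, 0) - C c : DiffPoly K ι) = X (i, k) - C ((fun a : K => a′)^[k] c) := by
  induction k with
  | zero => rfl
  | succ k ih => simp only [Function.iterate_succ_apply', ih, map_sub, D_X, D_C]

theorem aff_single (v : Fin n × ℕ) (c : K) :
    S.aff (Finsupp.single v c) = c • (X v - C ((fun a : K => a′)^[v.2] (S.a v.1))) := by
  rw [aff, Finsupp.linearCombination_single, iterate_D_X_sub_C]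

theorem exists_aff_eq (b : Fin n × ℕ →₀ K) : ∃ c, S.aff b = lin b + C c := by
  induction b using Finsupp.induction_linear with
  | zero => exact ⟨0, by simp⟩
  | add s t hs ht =>
    obtain ⟨c, hc⟩ := hs
    obtain ⟨c', hc'⟩ := ht
    exact ⟨c + c', by simp only [map_add, hc, hc']; ring⟩
  | single v c =>
    refine ⟨-(c * ((fun a : K => a′)^[v.2] (S.a v.1))), ?_⟩
    rw [aff_single, lin_single, smul_sub, map_neg, map_mul, ← MvPolynomial.smul_eq_C_mul]
    rw [sub_eq_add_neg]

theorem coeff_aff (b : Fin n × ℕ →₀ K) (v : Fin n × ℕ) :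
    coeff (Finsupp.single v 1) (S.aff b) = b v := by
  obtain ⟨c, hc⟩ := S.exists_aff_eq b
  rw [hc, coeff_lin_add_C]

theorem aff_injective : Function.Injective S.aff := by
  intro b b' h
  ext v
  rw [← S.coeff_aff, h, coeff_aff]

theorem totalDegree_aff_le (b : Fin n × ℕ →₀ K) : (S.aff b).totalDegree ≤ 1 := by
  obtain ⟨c, hc⟩ := S.exists_aff_eq b
  rw [hc]
  exact totalDegree_lin_add_C_le b c

theorem mem_vars_aff {b : Fin n × ℕ →₀ K} {v : Fin n × ℕ} : v ∈ (S.aff b).vars ↔ b v ≠ 0 := by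
  obtain ⟨c, hc⟩ := S.exists_aff_eq b
  rw [hc, mem_vars_lin_add_C]

theorem aff_mem_supported {b : Fin n × ℕ →₀ K} {s : Set (Fin n × ℕ)} :
    S.aff b ∈ supported K s ↔ b ∈ Finsupp.supported K K s := by
  obtain ⟨c, hc⟩ := S.exists_aff_eq b
  rw [hc, lin_add_C_mem_supported]

theorem iterate_D_P (i : Fin n) (k : ℕ) :
    D^[k] (S.P i) = lin (shiftDeriv^[k] (S.form i)) + C ((fun a : K => a′)^[k] (S.a i)) := by
  rw [P_eq, iterate_D_lin_add_C]

theorem eval_aff (b : Fin n × ℕ →₀ K) : S.eval (S.aff b) = lin (S.formMap b) := by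
  induction b using Finsupp.induction_linear with
  | zero => simp
  | add s t hs ht => simp only [map_add, hs, ht]
  | single v c =>
    rw [aff_single, map_smul, map_sub, eval_X, eval_C, iterate_D_P, add_sub_cancel_right, formMap,
      Finsupp.linearCombination_single, map_smul]

theorem aff_mem_ID {b : Fin n × ℕ →₀ K} : S.aff b ∈ S.ID ↔ S.formMap b = 0 := by
  rw [mem_ID, eval_aff]
  exact map_eq_zero_iff _ lin_injective

/-- Forms in the `x_i - a_i` map to forms without constant term, so any leftover constant survives
the substitution and must vanish. -/
theorem exists_aff_of_mem_ID {f : DiffPoly K (Fin n)} (hf : f ∈ S.ID) (hdeg : f.totalDegree ≤ 1) :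
    ∃ b, S.formMap b = 0 ∧ f = S.aff b := by
  obtain ⟨b, c, rfl⟩ := exists_eq_lin_add_C hdeg
  obtain ⟨c', hc'⟩ := S.exists_aff_eq b
  have h : lin b + C c = S.aff b + C (c - c') := by rw [hc', map_sub]; ring
  rw [h, mem_ID, map_add, eval_aff, eval_C] at hf
  have h0 : c - c' = 0 := by
    have := congrArg constantCoeff hf
    rwa [map_add, constantCoeff_lin, constantCoeff_C, zero_add, map_zero] at this
  rw [h0, map_zero, add_zero] at hf h
  exact ⟨b, lin_injective (by rw [hf, map_zero]), h⟩

/-- If the linear parts of the images of the variables in `Y` are linearly independent, then these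
images are algebraically independent. -/
theorem eq_zero_of_mem_ID {Y : Set (Fin n × ℕ)}
    (hY : ∀ b ∈ Finsupp.supported K K Y, S.formMap b = 0 → b = 0)
    {f : DiffPoly K (Fin n)} (hf : f ∈ S.ID) (hfY : f ∈ supported K Y) : f = 0 := by
  -- A linear left inverse of `formMap` on `Y` extends to an algebra map `θ`; after `θ`, the
  -- translation `τ` removes the constants coming from the `a_i`. So `τ ∘ θ ∘ eval` is the identity
  -- on `K[Y]`.
  obtain ⟨π, hπ⟩ := LinearMap.exists_leftInverse_of_injective
    (S.formMap ∘ₗ (Finsupp.supported K K Y).subtype)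
    (LinearMap.ker_eq_bot'.mpr fun b hb => Subtype.ext (hY b.1 b.2 hb))
  let θ : DiffPoly K (Fin (n - 1)) →ₐ[K] DiffPoly K (Fin n) :=
    aeval fun u => lin (π (Finsupp.single u 1)).1
  have hθ : ∀ b, θ (lin b) = lin (π b).1 := by
    intro b
    induction b using Finsupp.induction_linear with
    | zero => simp
    | add s t hs ht => simp only [map_add, hs, ht, Submodule.coe_add]
    | single u c =>
      rw [lin_single, map_smul, aeval_X, ← map_smul, ← Submodule.coe_smul, ← map_smul,
        Finsupp.smul_single, smul_eq_mul, mul_one]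
  let τ : DiffPoly K (Fin n) →ₐ[K] DiffPoly K (Fin n) :=
    aeval fun v => X v - C ((fun a : K => a′)^[v.2] (S.a v.1))
  have key : supported K Y ≤ ((τ.comp θ).comp S.eval).equalizer (AlgHom.id K _) := by
    rw [supported_eq_adjoin_X]
    refine AlgHom.adjoin_le_equalizer _ _ ?_
    rintro _ ⟨v, hv, rfl⟩
    have hv' : (Finsupp.single v 1 : Fin n × ℕ →₀ K) ∈ Finsupp.supported K K Y :=
      Finsupp.single_mem_supported K 1 hv
    have h1 : π (S.formMap (Finsupp.single v 1)) = ⟨_, hv'⟩ := LinearMap.congr_fun hπ ⟨_, hv'⟩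
    have h2 : shiftDeriv^[v.2] (S.form v.1) = S.formMap (Finsupp.single v 1) := by
      rw [formMap, Finsupp.linearCombination_single, one_smul]
    change τ (θ (S.eval (X v))) = X v
    rw [eval_X, iterate_D_P, h2, map_add, hθ, h1, lin_single, one_smul, map_add, aeval_X,
      show θ (C _) = C _ from aeval_C _ _, show τ (C _) = C _ from aeval_C _ _,
      sub_add_cancel]
  have := key hfY
  change τ (θ (S.eval f)) = f at this
  rw [← this, S.mem_ID.mp hf, map_zero, map_zero]

end System

/-! ### Leaders and reduction -/

theorem Ranking.lt_trans {ι : Type*} (R : Ranking ι) {u v w : ι × ℕ} (h : R.lt u v)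
    (h' : R.lt v w) : R.lt u w :=
  have := R.isStrictTotalOrder
  _root_.trans h h'

theorem Ranking.lt_irrefl {ι : Type*} (R : Ranking ι) (v : ι × ℕ) : ¬ R.lt v v :=
  have := R.isStrictTotalOrder
  irrefl v

theorem Ranking.lt_of_lt {ι : Type*} (R : Ranking ι) (i : ι) {k l : ℕ} (h : k < l) :
    R.lt (i, k) (i, l) := by
  induction l, h using Nat.le_induction with
  | base => exact R.lt_deriv (i, k)
  | succ l _ ih => exact R.lt_trans ih (R.lt_deriv (i, l))

theorem exists_isLeader {K : Type*} [Field K] {ι : Type*} (R : Ranking ι) {f : DiffPoly K ι}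
    (h : f.vars.Nonempty) : ∃ v, IsLeader R f v := by
  classical
  have := R.isStrictTotalOrder
  let := linearOrderOfSTO R.lt
  exact ⟨f.vars.max' h, f.vars.max'_mem h, fun w hw hne =>
    lt_of_le_of_ne (f.vars.le_max' w hw) hne⟩

/-- Right division by `α` in row `i`: subtracting a multiple of `∂^m α` cancels the entry of order
`k + m`, and the orders decrease to below `k`. -/
theorem exists_reduction {K : Type*} [Field K] [Differential K] {ι : Type*} {α : ι × ℕ →₀ K} {i : ι}
    {k : ℕ} (hk : α (i, k) ≠ 0) (htop : ∀ l, k < l → α (i, l) = 0) (b : ι × ℕ →₀ K) :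
    ∃ (t : ℕ →₀ K) (b' : ι × ℕ →₀ K), b = op shiftDeriv α t + b' ∧ ∀ l, k ≤ l → b' (i, l) = 0 := by
  have key : ∀ (m : ℕ) (b : ι × ℕ →₀ K), (∀ l, k + m ≤ l → b (i, l) = 0) →
      ∃ (t : ℕ →₀ K) (b' : ι × ℕ →₀ K), b = op shiftDeriv α t + b' ∧ ∀ l, k ≤ l → b' (i, l) = 0 := by
    intro m
    induction m with
    | zero => exact fun b hb => ⟨0, b, by simp, hb⟩
    | succ m ih =>
      intro b hb
      obtain ⟨h1, h2⟩ := iterate_shiftDeriv_top htop m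
      obtain ⟨t, b', ht, hb'⟩ := ih (b - (b (i, k + m) / α (i, k)) • shiftDeriv^[m] α) fun l hl => by
        rw [Finsupp.sub_apply, Finsupp.smul_apply, smul_eq_mul]
        rcases hl.eq_or_lt with rfl | hl
        · rw [h1, div_mul_cancel₀ _ hk, sub_self]
        · rw [h2 l hl, hb l (by omega), mul_zero, sub_zero]
      refine ⟨t + Finsupp.single m (b (i, k + m) / α (i, k)), b', ?_, hb'⟩
      rw [map_add, op_single, add_right_comm, ← ht, sub_add_cancel]
  refine key (b.support.sup fun v => v.2 + 1) b fun l hl => ?_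
  by_contra hne
  have := Finset.le_sup (f := fun v : ι × ℕ => v.2 + 1) (Finsupp.mem_support_iff.mpr hne)
  simp only at this
  omega

/-! ### Boxes of derivatives -/

section Box

variable {K : Type*} [Field K] {ι : Type*} [Fintype ι]

theorem finite_box (f : ι → ℕ) : Finite {v : ι × ℕ | v.2 < f v.1} := by
  refine Set.Finite.subset (Set.Finite.prod Set.finite_univ (Set.finite_Iio (∑ i, f i))) ?_
  intro v hv
  exact ⟨Set.mem_univ _, lt_of_lt_of_le hv
    (Finset.single_le_sum (fun _ _ => Nat.zero_le _) (Finset.mem_univ v.1))⟩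

/-- The elements of the box `{(i, k) | k < f i}`. -/
def boxEquiv (f : ι → ℕ) : {v : ι × ℕ | v.2 < f v.1} ≃ Σ i, Fin (f i) where
  toFun v := ⟨v.1.1, v.1.2, v.2⟩
  invFun w := ⟨(w.1, w.2), w.2.2⟩
  left_inv _ := rfl
  right_inv _ := rfl

instance finiteDimensional_supported {σ : Type*} (s : Set σ) [Finite s] :
    FiniteDimensional K (Finsupp.supported K K s) :=
  Module.Finite.equiv (Finsupp.supportedEquivFinsupp s).symm

theorem finrank_supported {σ : Type*} (s : Set σ) [Finite s] :
    Module.finrank K (Finsupp.supported K K s) = Nat.card s := by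
  have := Fintype.ofFinite s
  rw [(Finsupp.supportedEquivFinsupp (M := K) (R := K) s).finrank_eq, Module.finrank_finsupp_self,
    Nat.card_eq_fintype_card]

theorem finrank_box (f : ι → ℕ) :
    Module.finrank K (Finsupp.supported K K {v : ι × ℕ | v.2 < f v.1}) = ∑ i, f i := by
  have := finite_box f
  rw [finrank_supported, Nat.card_congr (boxEquiv f), Nat.card_sigma]
  simp

/-- Rank–nullity for `φ` restricted to `W`, with the image bounded by `W'` and the kernel covered by
`ψ(W'')`. -/
theorem finrank_le_add_of_map_le {V V' V'' : Type*} [AddCommGroup V] [Module K V] [AddCommGroup V']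
    [Module K V'] [AddCommGroup V''] [Module K V''] (φ : V →ₗ[K] V') (ψ : V'' →ₗ[K] V)
    (W : Submodule K V) (W' : Submodule K V') (W'' : Submodule K V'') [FiniteDimensional K W]
    [FiniteDimensional K W'] [FiniteDimensional K W''] (h : W.map φ ≤ W')
    (h' : ∀ b ∈ W, φ b = 0 → b ∈ W''.map ψ) :
    Module.finrank K W ≤ Module.finrank K W' + Module.finrank K W'' := by
  rw [← LinearMap.finrank_range_add_finrank_ker (φ.domRestrict W)]
  refine Nat.add_le_add ?_ ?_
  · rw [LinearMap.range_domRestrict]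
    exact Submodule.finrank_mono h
  · rw [← Submodule.finrank_map_subtype_eq]
    refine (Submodule.finrank_mono ?_).trans (Submodule.finrank_map_le ψ W'')
    rintro _ ⟨b, hb, rfl⟩
    exact h' b.1 b.2 hb

end Box

/-! ### The generator of the linear part of `ID` and its order bound -/

namespace System

variable {K : Type*} [Field K] {n : ℕ} (S : System K n)

theorem pos (S : System K n) : 0 < n := by
  obtain ⟨i, _⟩ := S.exists_not_const
  exact i.pos

theorem coeff_F_inr (i : Fin n) (u : Fin (n - 1) × ℕ) :
    coeff (Finsupp.single (Sum.inr u.1, u.2) 1) (S.F i) = -S.form i u := by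
  classical
  have hinj : Function.Injective
      (fun v : Fin (n - 1) × ℕ => ((Sum.inr v.1, v.2) : (Fin n ⊕ Fin (n - 1)) × ℕ)) := by
    rintro ⟨a, b⟩ ⟨a', b'⟩ h
    simpa using h
  have h1 := coeff_rename_mapDomain _ hinj (S.P i) (Finsupp.single u 1)
  rw [Finsupp.mapDomain_single] at h1
  rw [F, coeff_sub, inU, h1, P_eq, coeff_lin_add_C, coeff_X, if_neg, zero_sub]
  intro h
  simpa using (Finsupp.single_left_injective one_ne_zero h)

theorem add_gammaU_le {i : Fin n} {u : Fin (n - 1) × ℕ} (h : S.form i u ≠ 0) :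
    (u.2 : ℤ) + S.gammaU u.1 ≤ S.o i := by
  have h1 : S.gammaU u.1 ≤ (S.o i : ℤ) - ord (S.F i) (Sum.inr u.1) :=
    ciInf_le (Set.finite_range _).bddBelow i
  have h2 : (Sum.inr u.1, u.2) ∈ (S.F i).vars := by
    rw [mem_vars_iff_mem_support]
    refine ⟨Finsupp.single (Sum.inr u.1, u.2) 1, ?_, by simp⟩
    rw [mem_support_iff, coeff_F_inr]
    exact neg_ne_zero.mpr h
  have h3 := le_ord h2
  simp only at h3
  omega

variable [Differential K]

/-- The linear elements of `ID` are exactly the derived forms of the form `α`. -/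
def IsGenerator (α : Fin n × ℕ →₀ K) : Prop :=
  α ≠ 0 ∧ ∀ b, S.formMap b = 0 ↔ ∃ t : ℕ →₀ K, b = op shiftDeriv α t

theorem IsGenerator.formMap_eq_zero {S : System K n} {α : Fin n × ℕ →₀ K} (h : S.IsGenerator α) :
    S.formMap α = 0 :=
  (h.2 α).mpr ⟨Finsupp.single 0 1, by rw [op_single, one_smul]; rfl⟩

theorem exists_isGenerator (hdim : HasDiffDim S.ID (n - 1)) : ∃ α, S.IsGenerator α := by
  obtain ⟨R, C, ⟨hchain, hmem, hmin⟩, hlen⟩ := hdim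
  have hn := S.pos
  obtain ⟨f, rfl⟩ := List.length_eq_one_iff.mp (by omega : C.length = 1)
  obtain ⟨v, hv⟩ := hchain.1 f (by simp)
  have hf : f ∈ S.ID := hmem f (by simp)
  have hlow : ∀ g ∈ S.ID, ¬ RankLT R g f := by
    intro g hg hlt
    have hlt' := hlt
    obtain ⟨u, _, hu, -⟩ := hlt
    refine hmin [g] ⟨?_, by simp, ?_⟩ (by simpa using hg) (Or.inl hlt')
    · intro g' hg'
      rw [List.mem_singleton.mp hg']
      exact ⟨u, hu⟩
    · simp
  -- Otherwise the images of the variables of `f` would be algebraically independent, forcing `f =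
  -- 0`.
  obtain ⟨α, hsupp, hα0, hα⟩ : ∃ α ∈ Finsupp.supported K K (f.vars : Set (Fin n × ℕ)),
      S.formMap α = 0 ∧ α ≠ 0 := by
    by_contra! hcon
    have := S.eq_zero_of_mem_ID hcon hf (mem_supported.mpr subset_rfl)
    rw [this] at hv
    simpa using hv.1
  have hvars : (S.aff α).vars ⊆ f.vars := fun w hw =>
    hsupp (Finsupp.mem_support_iff.mpr (S.mem_vars_aff.mp hw))
  have hne : ∀ b : Fin n × ℕ →₀ K, b ≠ 0 → (S.aff b).vars.Nonempty := fun b hb => by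
    obtain ⟨w, hw⟩ := Finsupp.ne_iff.mp hb
    exact ⟨w, S.mem_vars_aff.mpr hw⟩
  obtain ⟨w, hw⟩ := exists_isLeader R (hne α hα)
  have hαID := S.aff_mem_ID.mpr hα0
  have hwv : w = v := by
    by_contra hwv
    exact hlow _ hαID ⟨w, v, hw, hv, Or.inl (hv.2 w (hvars hw.1) hwv)⟩
  subst hwv
  have hrank : RankEq R (S.aff α) f := by
    refine ⟨w, hw, hv, le_antisymm ?_ ?_⟩
    · exact ((degreeOf_le_totalDegree _ _).trans (S.totalDegree_aff_le α)).trans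
        (Nat.one_le_iff_ne_zero.mpr (mem_vars_iff_degreeOf_ne_zero.mp hv.1))
    · by_contra hlt
      exact hlow _ hαID ⟨w, w, hw, hv, Or.inr ⟨rfl, not_le.mp hlt⟩⟩
  obtain ⟨i, k⟩ := w
  have htop : ∀ l, k < l → α (i, l) = 0 := by
    intro l hl
    by_contra hne
    refine R.lt_irrefl (i, k) (R.lt_trans (R.lt_of_lt i hl) (hw.2 _ (S.mem_vars_aff.mpr hne) ?_))
    simpa using hl.ne'
  refine ⟨α, hα, fun b => ⟨fun hb => ?_, ?_⟩⟩
  · obtain ⟨t, b', rfl, hb'⟩ := exists_reduction (S.mem_vars_aff.mp hw.1) htop b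
    suffices b' = 0 from ⟨t, by rw [this, add_zero]⟩
    by_contra hb0
    obtain ⟨u, hu⟩ := exists_isLeader R (hne b' hb0)
    rw [map_add, formMap_op, hα0] at hb
    have hb'ID : S.aff b' ∈ S.ID := by
      rw [aff_mem_ID, ← hb]
      rw [op_zero (map_zero _), zero_add]
    have hu' := S.mem_vars_aff.mp hu.1
    -- A lower leader contradicts the minimality of `f`; an equal one was removed by the reduction.
    have hlt : R.lt (i, k) u := by
      have := R.isStrictTotalOrder
      rcases trichotomous_of R.lt (i, k) u with h | rfl | h
      · exact h
      · exact absurd (hb' k le_rfl) hu'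
      · exact absurd ⟨u, (i, k), hu, hv, Or.inl h⟩ (hlow _ hb'ID)
    have hnot : ∀ l, u.2 ≤ l → (u.1, l) ∉ (S.aff α).vars := by
      intro l hl hmem
      have h1 : R.lt (i, k) (u.1, l) := by
        rcases hl.eq_or_lt with rfl | hl
        · exact hlt
        · exact R.lt_trans hlt (R.lt_of_lt u.1 hl)
      by_cases heq : (u.1, l) = (i, k)
      · rw [heq] at h1
        exact R.lt_irrefl _ h1
      · exact R.lt_irrefl _ (R.lt_trans h1 (hw.2 _ hmem heq))
    have hnot' : ∀ l, k ≤ l → (i, l) ∉ (S.aff b').vars := fun l hl hmem =>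
      S.mem_vars_aff.mp hmem (hb' l hl)
    have hdeg : ∀ {g : DiffPoly K (Fin n)} {x}, x ∉ g.vars → g.degreeOf x = 0 := fun hx => by
      rwa [mem_vars_iff_degreeOf_ne_zero, not_not] at hx
    have hdeg' : ∀ {g : DiffPoly K (Fin n)} {x}, x ∈ g.vars → 0 < g.degreeOf x := fun hx =>
      Nat.pos_of_ne_zero (mem_vars_iff_degreeOf_ne_zero.mp hx)
    -- The first entry has the rank of `f`, and a proper continuation counts as lower than `[f]`.
    refine hmin [S.aff α, S.aff b'] ⟨?_, ?_, ?_⟩ ?_ (Or.inr ⟨hrank, trivial⟩)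
    · rintro g hg
      rcases List.mem_pair.mp hg with rfl | rfl
      exacts [⟨_, hw⟩, ⟨_, hu⟩]
    · exact List.pairwise_pair.mpr ⟨_, _, hw, hu, Or.inl hlt⟩
    · intro g hg h hh hgh
      rcases List.mem_pair.mp hg with rfl | rfl <;> rcases List.mem_pair.mp hh with rfl | rfl
      · exact absurd rfl hgh
      · refine ⟨u, hu, fun l hl => hnot l hl.le, ?_⟩
        rw [hdeg (hnot u.2 le_rfl)]
        exact hdeg' hu.1
      · refine ⟨_, hw, fun l hl => hnot' l hl.le, ?_⟩
        rw [hdeg (hnot' k le_rfl)]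
        exact hdeg' hw.1
      · exact absurd rfl hgh
    · rintro g hg
      rcases List.mem_pair.mp hg with rfl | rfl
      exacts [hαID, hb'ID]
  · rintro ⟨t, rfl⟩
    rw [formMap_op, hα0, op_zero (map_zero _)]

/-- Let `E` be the maximum of `k + o_i` over the variables of `α`. For large `M`, `formMap` sends
the box `k < M + 1 - o_i` into the box `l < M + 1 - γ_j`, and its kernel there consists of `tα` with
`t` of order below `M + 1 - E`. So `n(M + 1) - N ≤ (n - 1)(M + 1) - γ + (M + 1 - E)`, that is `E ≤ N
- γ`. -/
theorem IsGenerator.mem_varsX {S : System K n} {α : Fin n × ℕ →₀ K} (hα : S.IsGenerator α)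
    {v : Fin n × ℕ} (hv : α v ≠ 0) : v ∈ S.varsX := by
  obtain ⟨⟨i, k⟩, hik, hmax⟩ := Finset.exists_max_image α.support (fun v => v.2 + S.o v.1)
    ⟨v, Finsupp.mem_support_iff.mpr hv⟩
  have hv' := hmax v (Finsupp.mem_support_iff.mpr hv)
  set E := k + S.o i with hE
  change v.2 + S.o v.1 ≤ E at hv'
  suffices (E : ℤ) ≤ S.N - S.gamma by
    simp only [varsX, Set.mem_ofPred_eq]; omega
  -- Large enough for all the truncated subtractions and `toNat` below to be exact.
  set M : ℕ := E + S.N + ∑ j, (S.gammaU j).natAbs with hM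
  have hoM : ∀ i, S.o i ≤ M := fun i => by
    have : S.o i ≤ S.N := Finset.single_le_sum (fun _ _ => Nat.zero_le _) (Finset.mem_univ i)
    omega
  have hgM : ∀ j, S.gammaU j ≤ M := fun j => by
    have : (S.gammaU j).natAbs ≤ ∑ j, (S.gammaU j).natAbs :=
      Finset.single_le_sum (f := fun j => (S.gammaU j).natAbs)
        (fun _ _ => Nat.zero_le _) (Finset.mem_univ j)
    omega
  have := finite_box fun i => M + 1 - S.o i
  have := finite_box fun j => (M + 1 - S.gammaU j).toNat
  have : Finite (Set.Iio (M + 1 - E)) := (Set.finite_Iio _).to_subtype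
  have hrank := finrank_le_add_of_map_le S.formMap (op (K := K) shiftDeriv α)
    (Finsupp.supported K K {v : Fin n × ℕ | v.2 < M + 1 - S.o v.1})
    (Finsupp.supported K K {v : Fin (n - 1) × ℕ | v.2 < (M + 1 - S.gammaU v.1).toNat})
    (Finsupp.supported K K (Set.Iio (M + 1 - E))) ?_ ?_
  · rw [finrank_box fun i => M + 1 - S.o i, finrank_box fun j => (M + 1 - S.gammaU j).toNat,
      finrank_supported, Nat.card_coe_set_eq, Set.ncard_Iio_nat] at hrank
    zify at hrank
    have h1 : ∑ i, ((M + 1 - S.o i : ℕ) : ℤ) = n * (M + 1) - S.N := by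
      have h : ∀ i, ((M + 1 - S.o i : ℕ) : ℤ) = (M + 1) - S.o i := fun i => by
        have := hoM i; omega
      simp [h, N, Finset.sum_sub_distrib]
    have h2 : ∑ j, ((M + 1 - S.gammaU j).toNat : ℤ) = (n - 1 : ℕ) * (M + 1) - S.gamma := by
      have h : ∀ j, ((M + 1 - S.gammaU j).toNat : ℤ) = (M + 1) - S.gammaU j := fun j => by
        have := hgM j; omega
      simp [h, gamma, Finset.sum_sub_distrib]
    rw [h1, h2, Nat.cast_sub S.pos, Nat.cast_sub (by omega)] at hrank
    push_cast at hrank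
    linarith
  · rw [Finsupp.supported_eq_span_single, Submodule.map_span_le]
    rintro _ ⟨v, hv, rfl⟩
    rw [formMap, Finsupp.linearCombination_single, one_smul, Finsupp.mem_supported]
    intro u hu
    obtain ⟨l, hl, hle⟩ := exists_of_iterate_shiftDeriv_ne_zero (Finsupp.mem_support_iff.mp hu)
    have := S.add_gammaU_le hl
    simp only [Set.mem_ofPred_eq] at hv ⊢
    simp only at this
    omega
  · intro b hb hb0
    obtain ⟨t, rfl⟩ := (hα.2 b).mp hb0
    refine ⟨t, ?_, rfl⟩
    intro l hl
    rw [Finset.mem_coe] at hl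
    obtain ⟨d, hd, hdtop⟩ := exists_top_finsupp (Finsupp.support_nonempty_iff.mp ⟨l, hl⟩)
    have htop : ∀ l, k < l → α (i, l) = 0 := by
      intro l hl
      by_contra hne
      have := hmax (i, l) (Finsupp.mem_support_iff.mpr hne)
      simp only at this
      omega
    -- In the row where `k + o_i = E`, the top entry of `tα` has order `k + d`; lying in the box
    -- forces `d < M + 1 - E`.
    have hne : op shiftDeriv α t (i, k + d) ≠ 0 := by
      rw [(op_shiftDeriv_top htop hdtop).1]
      exact mul_ne_zero hd (Finsupp.mem_support_iff.mp hik)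
    have hbox := hb (Finsupp.mem_support_iff.mpr hne)
    simp only [Set.mem_ofPred_eq] at hbox
    have hld : l ≤ d := by
      by_contra hlt
      exact Finsupp.mem_support_iff.mp hl (hdtop l (not_le.mp hlt))
    rw [Set.mem_Iio]
    omega

end System

/-! ### The elimination order -/

/-- The inclusion of the derivatives of the `x`'s in the derivatives of the `x`'s and `u`'s. -/
def varX {n : ℕ} (v : Fin n × ℕ) : (Fin n ⊕ Fin (n - 1)) × ℕ := (Sum.inl v.1, v.2)

theorem varX_injective {n : ℕ} : Function.Injective (varX (n := n)) := by
  rintro ⟨a, b⟩ ⟨a', b'⟩ h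
  simpa [varX] using h

theorem rankStar_varX_le_iff {n : ℕ} {v w : Fin n × ℕ} :
    rankStar n (varX v) ≤ rankStar n (varX w) ↔ w.1 < v.1 ∨ (v.1 = w.1 ∧ v.2 ≤ w.2) := by
  change Sum.inlₗ _ ≤ Sum.inlₗ _ ↔ _
  rw [Sum.Lex.inl_le_inl_iff, Prod.Lex.toLex_le_toLex]
  rfl

/-- Indices carry the dual of `rankStar`, so agreement at smaller indices means agreement at higher
variables. -/
theorem lexStar_lt_iff {n : ℕ} {a b : (Fin n ⊕ Fin (n - 1)) × ℕ →₀ ℕ} :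
    a ≺[lexStar n] b ↔ ∃ w, (∀ w', rankStar n w < rankStar n w' → a w' = b w') ∧ a w < b w :=
  Iff.rfl

theorem single_le_single_of_rankStar_le {n : ℕ} {v w : (Fin n ⊕ Fin (n - 1)) × ℕ}
    (h : rankStar n v ≤ rankStar n w) : Finsupp.single v 1 ≼[lexStar n] Finsupp.single w 1 := by
  rcases h.eq_or_lt with h | h
  · rw [rankStar_injective n h]
  · refine le_of_lt (lexStar_lt_iff.mpr ⟨w, fun x hx => ?_, ?_⟩)
    · rw [Finsupp.single_eq_of_ne, Finsupp.single_eq_of_ne]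
      · rintro rfl; exact lt_irrefl _ hx
      · rintro rfl; exact lt_irrefl _ (hx.trans h)
    · rw [Finsupp.single_eq_same, Finsupp.single_eq_of_ne]
      · exact Nat.one_pos
      · rintro rfl; exact lt_irrefl _ h

/-- The elimination property: the highest variable of a monomial decides its comparison with a
single variable. -/
theorem rankStar_le_of_le_single {n : ℕ} {a : (Fin n ⊕ Fin (n - 1)) × ℕ →₀ ℕ}
    {w : (Fin n ⊕ Fin (n - 1)) × ℕ} (h : a ≼[lexStar n] Finsupp.single w 1)
    {x : (Fin n ⊕ Fin (n - 1)) × ℕ} (hx : a x ≠ 0) : rankStar n x ≤ rankStar n w := by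
  by_contra hlt
  obtain ⟨y, hy, hmax⟩ := Finset.exists_max_image a.support (rankStar n)
    ⟨x, Finsupp.mem_support_iff.mpr hx⟩
  have hwy : rankStar n w < rankStar n y :=
    (not_le.mp hlt).trans_le (hmax x (Finsupp.mem_support_iff.mpr hx))
  refine not_lt.mpr h (lexStar_lt_iff.mpr ⟨y, fun z hz => ?_, ?_⟩)
  · rw [Finsupp.single_eq_of_ne]
    · by_contra hne
      exact not_lt.mpr (hmax z (Finsupp.mem_support_iff.mpr (Ne.symm hne))) hz
    · rintro rfl; exact lt_irrefl _ (hz.trans hwy)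
  · rw [Finsupp.single_eq_of_ne]
    · exact Nat.pos_of_ne_zero (Finsupp.mem_support_iff.mp hy)
    · rintro rfl; exact lt_irrefl _ hwy

/-! ### Leaders, normal forms and the equality of `ID` with `[A]` -/

namespace System

variable {K : Type*} [Field K] {n : ℕ}

theorem support_inX (f : DiffPoly K (Fin n)) :
    (inX f).support = f.support.image (Finsupp.mapDomain varX) := by
  classical
  convert support_rename_of_injective (p := f) varX_injective
  rfl

theorem coeff_inX (f : DiffPoly K (Fin n)) (m : Fin n × ℕ →₀ ℕ) :
    coeff (Finsupp.mapDomain varX m) (inX f) = coeff m f :=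
  coeff_rename_mapDomain _ varX_injective f m

theorem inX_injective : Function.Injective (inX (K := K) (n := n)) :=
  rename_injective _ varX_injective

theorem degree_inX_lin_add_C_le {b : Fin n × ℕ →₀ K} {c : K} {v : Fin n × ℕ}
    (h : ∀ w, b w ≠ 0 → rankStar n (varX w) ≤ rankStar n (varX v)) :
    (lexStar n).degree (inX (lin b + C c)) ≼[lexStar n] Finsupp.single (varX v) 1 := by
  rw [MonomialOrder.degree_le_iff]
  intro m hm
  rw [support_inX] at hm
  obtain ⟨a, ha, rfl⟩ := Finset.mem_image.mp hm
  rcases mem_support_lin_add_C ha with rfl | ⟨w, hw, rfl⟩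
  · rw [Finsupp.mapDomain_zero, map_zero]
    exact MonomialOrder.zero_le _ _
  · rw [Finsupp.mapDomain_single]
    exact single_le_single_of_rankStar_le (h w hw)

/-- `v` is the leader of the linear form with coefficients `α`. -/
def IsLead (α : Fin n × ℕ →₀ K) (v : Fin n × ℕ) : Prop :=
  α v ≠ 0 ∧ ∀ w, α w ≠ 0 → rankStar n (varX w) ≤ rankStar n (varX v)

theorem exists_isLead {α : Fin n × ℕ →₀ K} (h : α ≠ 0) : ∃ v, IsLead α v := by
  obtain ⟨v, hv, hmax⟩ := Finset.exists_max_image α.support (fun v => rankStar n (varX v))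
    (Finsupp.support_nonempty_iff.mpr h)
  exact ⟨v, Finsupp.mem_support_iff.mp hv, fun w hw => hmax w (Finsupp.mem_support_iff.mpr hw)⟩

theorem IsLead.top {α : Fin n × ℕ →₀ K} {v : Fin n × ℕ} (h : IsLead α v) :
    ∀ l, v.2 < l → α (v.1, l) = 0 := by
  intro l hl
  by_contra hne
  rcases rankStar_varX_le_iff.mp (h.2 _ hne) with h1 | ⟨-, h1⟩
  · exact lt_irrefl _ h1
  · exact not_lt.mpr h1 hl

theorem degree_inX_aff (S : System K n) [Differential K] {α : Fin n × ℕ →₀ K} {v : Fin n × ℕ}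
    (h : IsLead α v) : (lexStar n).degree (inX (S.aff α)) = Finsupp.single (varX v) 1 := by
  obtain ⟨c, hc⟩ := S.exists_aff_eq α
  refine (lexStar n).toSyn.injective (le_antisymm ?_ ((lexStar n).le_degree ?_))
  · rw [hc]
    exact degree_inX_lin_add_C_le h.2
  · rw [mem_support_iff, ← Finsupp.mapDomain_single, coeff_inX, coeff_aff]
    exact h.1

variable [Differential K]

theorem IsLead.iterate {α : Fin n × ℕ →₀ K} {v : Fin n × ℕ} (h : IsLead α v) (m : ℕ) :
    IsLead (shiftDeriv^[m] α) (v.1, v.2 + m) := by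
  refine ⟨by rw [(iterate_shiftDeriv_top h.top m).1]; exact h.1, fun w hw => ?_⟩
  obtain ⟨k, hk, hle⟩ := exists_of_iterate_shiftDeriv_ne_zero hw
  rw [rankStar_varX_le_iff]
  rcases rankStar_varX_le_iff.mp (h.2 _ hk) with h1 | ⟨h1, h2⟩
  · exact Or.inl h1
  · exact Or.inr ⟨h1, by simp only at h2 ⊢; omega⟩

/-- The leaders of the derivatives of `α` that only involve variables in `Y`. -/
def leaders (α : Fin n × ℕ →₀ K) (v : Fin n × ℕ) (Y : Set (Fin n × ℕ)) : Set (Fin n × ℕ) :=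
  {w | ∃ m, w = (v.1, v.2 + m) ∧ shiftDeriv^[m] α ∈ Finsupp.supported K K Y}

variable (S : System K n) {α : Fin n × ℕ →₀ K} {v₀ : Fin n × ℕ} {Y : Set (Fin n × ℕ)}

theorem IsGenerator.formMap_iterate {S : System K n} (hα : S.IsGenerator α) (m : ℕ) :
    S.formMap (shiftDeriv^[m] α) = 0 :=
  (hα.2 _).mpr ⟨Finsupp.single m 1, by rw [op_single, one_smul]⟩

/-- If `tα ≠ 0` is supported in `Y` with `t` of order `d`, the tops of its rows are those of `∂^d
α`. As `Y` is closed under lowering orders, `∂^d α` is supported in `Y`, and its leader occurs in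
`tα`. -/
theorem IsGenerator.eq_zero_of_supported {S : System K n} (hα : S.IsGenerator α)
    (hv : IsLead α v₀) (hY : ∀ i k l, l ≤ k → (i, k) ∈ Y → (i, l) ∈ Y) :
    ∀ b ∈ Finsupp.supported K K (Y \ leaders α v₀ Y), S.formMap b = 0 → b = 0 := by
  intro b hb hb0
  obtain ⟨t, rfl⟩ := (hα.2 b).mp hb0
  by_contra hne
  have ht : t ≠ 0 := by rintro rfl; exact hne (map_zero _)
  obtain ⟨d, hd, hdtop⟩ := exists_top_finsupp ht
  have hmem : ∀ {i k}, α (i, k) ≠ 0 → (∀ l, k < l → α (i, l) = 0) →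
      (i, k + d) ∈ Y \ leaders α v₀ Y := fun hk htop => by
    refine hb (Finsupp.mem_support_iff.mpr ?_)
    rw [(op_shiftDeriv_top htop hdtop).1]
    exact mul_ne_zero hd hk
  refine (hmem hv.1 hv.top).2 ⟨d, rfl, ?_⟩
  rintro ⟨i, l⟩ hl
  obtain ⟨k, hk, hle⟩ := exists_of_iterate_shiftDeriv_ne_zero (Finsupp.mem_support_iff.mp hl)
  obtain ⟨k', hk', htop⟩ := exists_top_row hk
  have hkk : k ≤ k' := by
    by_contra hlt
    exact hk (htop k (not_le.mp hlt))
  exact hY i (k' + d) l (by simp only at hle; omega) (hmem hk' htop).1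

/-- Rewriting modulo the kernel: a leader is replaced by the lower terms of its form, still in `Y`,
and induction on the rank reaches non-leaders without ever rising. -/
theorem IsGenerator.single_mem_sup {S : System K n} (hα : S.IsGenerator α) (hv : IsLead α v₀)
    (v : Fin n × ℕ) (hvY : v ∈ Y) :
    Finsupp.single v 1 ∈ Finsupp.supported K K
      {w | w ∈ Y \ leaders α v₀ Y ∧ rankStar n (varX w) ≤ rankStar n (varX v)} ⊔
        S.formMap.ker := by
  have hwf : WellFounded (InvImage (· < ·) fun v => rankStar n (varX v)) :=
    InvImage.wf _ (Sum.lex_wf (wellFounded_lt (α := (Fin n)ᵒᵈ ×ₗ ℕ))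
      (wellFounded_lt (α := ℕ ×ₗ Fin (n - 1))))
  induction v using hwf.induction with
  | _ v ih =>
  by_cases hL : v ∈ leaders α v₀ Y
  · obtain ⟨m, rfl, hm⟩ := hL
    have hlead := hv.iterate m
    set v := (v₀.1, v₀.2 + m)
    set β := shiftDeriv^[m] α
    -- The form `β` is solved for its leader; `β` itself is in the kernel.
    have hβ : Finsupp.single v 1 = (β v)⁻¹ • (β - β.erase v) := by
      rw [sub_eq_of_eq_add (Finsupp.single_add_erase v β).symm, Finsupp.smul_single, smul_eq_mul,
        inv_mul_cancel₀ hlead.1]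
    rw [hβ]
    refine Submodule.smul_mem _ _ (Submodule.sub_mem _
      (Submodule.mem_sup_right (LinearMap.mem_ker.mpr (hα.formMap_iterate m))) ?_)
    rw [← Finsupp.sum_single (β.erase v)]
    refine Submodule.sum_mem _ fun w hw => ?_
    rw [Finsupp.support_erase, Finset.mem_erase] at hw
    have hle := hlead.2 w (Finsupp.mem_support_iff.mp hw.2)
    have hlt : rankStar n (varX w) < rankStar n (varX v) :=
      lt_of_le_of_ne hle fun h => hw.1 (varX_injective (rankStar_injective n h))
    have := ih w hlt (hm hw.2)
    rw [← mul_one (β.erase v w), ← smul_eq_mul, ← Finsupp.smul_single]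
    refine Submodule.smul_mem _ _ (SetLike.le_def.mp (sup_le_sup_right ?_ _) this)
    exact Finsupp.supported_mono fun x hx => ⟨hx.1, hx.2.trans hle⟩
  · exact Submodule.mem_sup_left (Finsupp.single_mem_supported K 1 ⟨⟨hvY, hL⟩, le_rfl⟩)

/-- The linear rewriting extended to a substitution `ρ`, which on `K[Y]` preserves classes modulo
`ID` and does not raise leading monomials. -/
theorem IsGenerator.exists_normalForm {S : System K n} (hα : S.IsGenerator α) (hv : IsLead α v₀) :
    ∃ ρ : DiffPoly K (Fin n) →ₐ[K] DiffPoly K (Fin n), ∀ v,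
      (v ∈ Y → ρ (X v) ∈ supported K (Y \ leaders α v₀ Y) ∧
        (lexStar n).degree (inX (ρ (X v))) ≼[lexStar n] Finsupp.single (varX v) 1 ∧
        ∃ b, S.formMap b = 0 ∧ ρ (X v) = X v - S.aff b) ∧
      (v ∉ leaders α v₀ Y → ρ (X v) = X v) := by
  suffices ∀ v, ∃ f : DiffPoly K (Fin n),
      (v ∈ Y → f ∈ supported K (Y \ leaders α v₀ Y) ∧
        (lexStar n).degree (inX f) ≼[lexStar n] Finsupp.single (varX v) 1 ∧
        ∃ b, S.formMap b = 0 ∧ f = X v - S.aff b) ∧ (v ∉ leaders α v₀ Y → f = X v) by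
    choose f hf using this
    exact ⟨aeval f, fun v => by simpa only [aeval_X] using hf v⟩
  intro v
  by_cases hL : v ∈ leaders α v₀ Y
  · by_cases hvY : v ∈ Y
    · obtain ⟨ν, hν, b, hb, hνb⟩ := Submodule.mem_sup.mp (hα.single_mem_sup hv v hvY)
      obtain ⟨c, hc⟩ := S.exists_aff_eq b
      have hX : X v - S.aff b = lin ν + C (-c) := by
        rw [hc, map_neg, ← one_smul K (X v : DiffPoly K (Fin n)), ← lin_single, ← hνb, map_add]
        ring
      refine ⟨X v - S.aff b, fun _ => ⟨?_, ?_, b, LinearMap.mem_ker.mp hb, rfl⟩,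
        fun h => absurd hL h⟩
      · rw [hX, lin_add_C_mem_supported]
        exact Finsupp.supported_mono (fun x hx => hx.1) hν
      · rw [hX]
        exact degree_inX_lin_add_C_le fun w hw => (hν (Finsupp.mem_support_iff.mpr hw)).2
    -- Both requirements are vacuous here, so any value serves.
    · exact ⟨0, fun h => absurd h hvY, fun h => absurd hL h⟩
  · refine ⟨X v, fun hvY => ⟨X_mem_supported.mpr ⟨hvY, hL⟩, ?_, 0, map_zero _, by simp⟩, fun _ => rfl⟩
    rw [inX, rename_X]
    exact MonomialOrder.degree_X_le_single

theorem aff_mem_diffIdeal {f : DiffPoly K (Fin n)} {b : Fin n × ℕ →₀ K} {t : ℕ →₀ K}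
    (hf : f = S.aff b) : S.aff (op shiftDeriv b t) ∈ diffIdeal {f} := by
  rw [aff_op, ← hf, op, Finsupp.linearCombination_apply]
  refine Ideal.sum_mem _ fun k _ => ?_
  beta_reduce
  rw [MvPolynomial.smul_eq_C_mul]
  exact Ideal.mul_mem_left _ _ (Ideal.subset_span ⟨f, rfl, k, rfl⟩)

/-- With `Y` the set of all variables, `ρ` is the identity modulo `[α]` and does not change the
substituted value. For `g ∈ ID`, `ρ g` lies in `ID` and in a ring of independent variables, so `ρ g
= 0` and `g ∈ [α]`. -/
theorem IsGenerator.ID_eq {S : System K n} (hα : S.IsGenerator α) :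
    S.ID = diffIdeal {S.aff α} := by
  refine le_antisymm (fun g hg => ?_) (Ideal.span_le.mpr ?_)
  · obtain ⟨v₀, hv⟩ := exists_isLead hα.1
    obtain ⟨ρ, hρ⟩ := hα.exists_normalForm (Y := Set.univ) hv
    have h1 : (Ideal.Quotient.mkₐ K (diffIdeal {S.aff α})).comp ρ =
        Ideal.Quotient.mkₐ K (diffIdeal {S.aff α}) := by
      refine MvPolynomial.algHom_ext fun v => ?_
      obtain ⟨b, hb, hbv⟩ := ((hρ v).1 trivial).2.2
      obtain ⟨t, rfl⟩ := (hα.2 b).mp hb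
      rw [AlgHom.comp_apply, hbv, map_sub, sub_eq_self]
      exact Ideal.Quotient.eq_zero_iff_mem.mpr (S.aff_mem_diffIdeal rfl)
    have h2 : S.eval.comp ρ = S.eval := by
      refine MvPolynomial.algHom_ext fun v => ?_
      obtain ⟨b, hb, hbv⟩ := ((hρ v).1 trivial).2.2
      rw [AlgHom.comp_apply, hbv, map_sub, sub_eq_self]
      exact S.aff_mem_ID.mpr hb
    have h3 : ρ g = 0 := by
      refine S.eq_zero_of_mem_ID (hα.eq_zero_of_supported (Y := Set.univ) hv fun _ _ _ _ _ => trivial)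
        (S.mem_ID.mpr ((AlgHom.congr_fun h2 g).trans hg)) ?_
      have : (⊤ : Subalgebra K (DiffPoly K (Fin n))) ≤
          (supported K (Set.univ \ leaders α v₀ Set.univ)).comap ρ := by
        rw [← MvPolynomial.adjoin_range_X, Algebra.adjoin_le_iff]
        rintro _ ⟨v, rfl⟩
        exact ((hρ v).1 trivial).1
      exact this trivial
    have h4 := AlgHom.congr_fun h1 g
    rw [AlgHom.comp_apply, h3, map_zero] at h4
    exact Ideal.Quotient.eq_zero_iff_mem.mp h4.symm
  · rintro _ ⟨g, rfl, k, rfl⟩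
    exact S.iterate_D_mem_ID (S.aff_mem_ID.mpr hα.formMap_eq_zero) k

/-- The leading monomial of a nonzero element of `ID` in the variables `Y` contains the leader
of a linear element of `ID` in these variables. -/
theorem IsGenerator.exists_degree_ne_zero {S : System K n} (hα : S.IsGenerator α)
    (hv : IsLead α v₀) (hY : ∀ i k l, l ≤ k → (i, k) ∈ Y → (i, l) ∈ Y)
    {g : DiffPoly K (Fin n)} (hg : g ∈ S.ID) (hgY : g ∈ supported K Y) (hg0 : g ≠ 0) :
    ∃ w ∈ leaders α v₀ Y, (lexStar n).degree (inX g) (varX w) ≠ 0 := by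
  by_contra! hcon
  obtain ⟨ρ, hρ⟩ := hα.exists_normalForm (Y := Y) hv
  have hin0 : inX g ≠ 0 := (map_ne_zero_iff _ inX_injective).mpr hg0
  have hdeg := (lexStar n).degree_mem_support hin0
  rw [support_inX] at hdeg
  obtain ⟨m₀, hm₀, hm₀d⟩ := Finset.mem_image.mp hdeg
  have h3 : ρ g = 0 := by
    refine S.eq_zero_of_mem_ID (hα.eq_zero_of_supported hv hY) (S.mem_ID.mpr ?_) ?_
    · have : supported K Y ≤ (S.eval.comp ρ).equalizer S.eval := by
        rw [supported_eq_adjoin_X]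
        refine AlgHom.adjoin_le_equalizer _ _ ?_
        rintro _ ⟨v, hvY, rfl⟩
        obtain ⟨b, hb, hbv⟩ := ((hρ v).1 hvY).2.2
        rw [AlgHom.comp_apply, hbv, map_sub, sub_eq_self]
        exact S.aff_mem_ID.mpr hb
      exact (this hgY).trans hg
    · have : supported K Y ≤ (supported K (Y \ leaders α v₀ Y)).comap ρ := by
        conv_lhs => rw [supported_eq_adjoin_X]
        rw [Algebra.adjoin_le_iff]
        rintro _ ⟨v, hvY, rfl⟩
        exact ((hρ v).1 hvY).1
      exact this hgY
  have hmon : ∀ a c, ρ (monomial a c) = C c * a.prod fun v k => ρ (X v) ^ k := by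
    intro a c
    rw [monomial_eq, map_mul, Finsupp.prod, map_prod]
    simp only [map_pow]
    congr 1
    exact AlgHom.commutes ρ c
  have hvars : ∀ a ∈ g.support, ∀ v ∈ a.support, v ∈ Y := fun a ha v hva =>
    mem_supported.mp hgY ((mem_vars_iff_mem_support _).mpr ⟨a, ha, hva⟩)
  -- A leading monomial free of leaders is fixed by `ρ`, and the smaller monomials stay below it, so
  -- its coefficient survives; but `ρ g = 0`.
  have h4 : coeff (Finsupp.mapDomain varX m₀) (inX (ρ g)) = coeff m₀ g := by
    conv_lhs => rw [g.as_sum]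
    rw [map_sum, map_sum, coeff_sum, Finset.sum_eq_single m₀]
    · have : ρ (monomial m₀ (coeff m₀ g)) = monomial m₀ (coeff m₀ g) := by
        rw [hmon, monomial_eq]
        congr 1
        refine Finsupp.prod_congr fun v hvm => ?_
        rw [(hρ v).2]
        intro hvL
        have := hcon v hvL
        rw [← hm₀d, Finsupp.mapDomain_apply varX_injective] at this
        exact Finsupp.mem_support_iff.mp hvm this
      rw [this, coeff_inX, coeff_monomial, if_pos rfl]
    · intro a ha hne
      refine MonomialOrder.coeff_eq_zero_of_lt (m := lexStar n) (lt_of_le_of_lt (b :=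
        (lexStar n).toSyn (Finsupp.mapDomain varX a)) ?_ ?_)
      · rw [hmon, Finsupp.prod, map_mul, map_prod]
        refine (MonomialOrder.degree_mul_le (m := lexStar n)).trans ?_
        have hC : (lexStar n).degree (inX (C (coeff a g) : DiffPoly K (Fin n))) = 0 := by
          rw [inX, rename_C, MonomialOrder.degree_C]
        rw [hC, zero_add]
        refine (MonomialOrder.degree_prod_le (m := lexStar n)).trans ?_
        rw [Finsupp.mapDomain, Finsupp.sum, map_sum, map_sum]
        refine Finset.sum_le_sum fun v hva => ?_
        rw [map_pow]
        refine (MonomialOrder.degree_pow_le (m := lexStar n) _).trans ?_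
        have h5 : Finsupp.single (varX v) (a v) = a v • Finsupp.single (varX v) 1 := by
          rw [Finsupp.smul_single, smul_eq_mul, mul_one]
        rw [h5, map_nsmul, map_nsmul]
        exact nsmul_le_nsmul_right ((hρ v).1 (hvars a ha v hva)).2.1 _
      · rw [hm₀d]
        refine lt_of_le_of_ne ((lexStar n).le_degree ?_) fun h => hne ?_
        · rw [support_inX]
          exact Finset.mem_image_of_mem _ ha
        · rw [← hm₀d] at h
          exact Finsupp.mapDomain_injective varX_injective ((lexStar n).toSyn.injective h)
    · intro h
      exact absurd hm₀ h
  rw [h3, map_zero, coeff_zero] at h4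
  exact mem_support_iff.mp hm₀ h4.symm

end System

/-! ### Differential operators as left polynomials in `∂` -/

section DiffOp

variable {K : Type*} [Field K] [Differential K] {ι : Type*}

theorem op_D_op_D (f : DiffPoly K ι) (s t : ℕ →₀ K) :
    op D (op D f t) s = op D f (op opDeriv t s) :=
  op_op (d := ⇑(D : Derivation ℤ (DiffPoly K ι) (DiffPoly K ι))) (fun x y => map_add D x y)
    D_smul f s t

theorem op_shiftDeriv_op_shiftDeriv (b : ι × ℕ →₀ K) (s t : ℕ →₀ K) :
    op shiftDeriv (op shiftDeriv b t) s = op shiftDeriv b (op opDeriv t s) :=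
  op_op (map_add _) shiftDeriv_smul b s t

/-- Leibniz's rule moves all coefficients to the left, so the generated ring consists of the sums `∑
t_k ∂^k`. -/
theorem exists_op_eq (T : DiffOp K ι) : ∃ t : ℕ →₀ K, ∀ f, T.1 f = op D f t := by
  obtain ⟨T, hT⟩ := T
  induction hT using Subring.closure_induction with
  | mem T hT =>
    rcases hT with ⟨c, hc⟩ | hT
    · refine ⟨Finsupp.single 0 c, fun f => ?_⟩
      rw [op_single, MvPolynomial.smul_eq_C_mul]
      exact hc f
    · refine ⟨Finsupp.single 1 1, fun f => ?_⟩
      rw [op_single, one_smul]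
      exact hT f
  | zero => exact ⟨0, fun f => by rw [map_zero]; rfl⟩
  | one => exact ⟨Finsupp.single 0 1, fun f => by rw [op_single, one_smul]; rfl⟩
  | add S T _ _ hS hT =>
    obtain ⟨s, hs⟩ := hS
    obtain ⟨t, ht⟩ := hT
    exact ⟨s + t, fun f => by rw [map_add, ← hs, ← ht]; rfl⟩
  | neg T _ hT =>
    obtain ⟨t, ht⟩ := hT
    exact ⟨-t, fun f => by rw [map_neg, ← ht]; rfl⟩
  | mul S T _ _ hS hT =>
    obtain ⟨s, hs⟩ := hS
    obtain ⟨t, ht⟩ := hT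
    refine ⟨op opDeriv t s, fun f => ?_⟩
    rw [← op_D_op_D, ← ht, ← hs]
    rfl

theorem exists_diffOp (t : ℕ →₀ K) : ∃ T : DiffOp K ι, ∀ f, T.1 f = op D f t := by
  induction t using Finsupp.induction_linear with
  | zero => exact ⟨0, fun f => by rw [map_zero]; rfl⟩
  | add s t hs ht =>
    obtain ⟨S, hS⟩ := hs
    obtain ⟨T, hT⟩ := ht
    exact ⟨S + T, fun f => by rw [map_add, ← hS, ← hT]; rfl⟩
  | single k c =>
    let E : DiffOp K ι := ⟨(D : Derivation ℤ (DiffPoly K ι) _).toLinearMap.toAddMonoidHom,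
      Subring.subset_closure (Or.inr fun _ => rfl)⟩
    let L : DiffOp K ι := ⟨AddMonoidHom.mulLeft (C c),
      Subring.subset_closure (Or.inl ⟨c, fun _ => rfl⟩)⟩
    have hE : ∀ k f, (E ^ k).1 f = D^[k] f := by
      intro k
      induction k with
      | zero => exact fun _ => rfl
      | succ k ih =>
        intro f
        rw [pow_succ, Function.iterate_succ_apply, ← ih]
        rfl
    refine ⟨L * E ^ k, fun f => ?_⟩
    rw [op_single, ← hE, MvPolynomial.smul_eq_C_mul]
    rfl

theorem DiffOp.ext {S T : DiffOp K ι} (h : ∀ f, S.1 f = T.1 f) : S = T :=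
  Subtype.ext (AddMonoidHom.ext h)

theorem DiffOp.mul_apply (S T : DiffOp K ι) (f : DiffPoly K ι) : (S * T).1 f = S.1 (T.1 f) := rfl

end DiffOp

/-- The finitely supported function on `ι × ℕ` with given rows. -/
def ofRows {K : Type*} [Field K] {ι : Type*} [Fintype ι] (τ : ι → ℕ →₀ K) : ι × ℕ →₀ K :=
  ∑ i, (τ i).mapDomain (Prod.mk i)

theorem ofRows_apply {K : Type*} [Field K] {ι : Type*} [Fintype ι] (τ : ι → ℕ →₀ K) (i : ι)
    (k : ℕ) : ofRows τ (i, k) = τ i k := by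
  rw [ofRows, Finsupp.finsetSum_apply, Finset.sum_eq_single i]
  · exact Finsupp.mapDomain_apply (Prod.mk_right_injective i) _ _
  · intro j _ hj
    refine Finsupp.mapDomain_of_notMem_range _ _ ?_
    rintro ⟨l, hl⟩
    exact hj (congrArg Prod.fst hl)
  · simp

theorem exists_ofRows_eq {K : Type*} [Field K] {ι : Type*} [Fintype ι] (α : ι × ℕ →₀ K) :
    ∃ τ : ι → ℕ →₀ K, ofRows τ = α := by
  refine ⟨fun i => α.comapDomain (Prod.mk i) (Prod.mk_right_injective i).injOn, ?_⟩
  ext ⟨i, k⟩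
  rw [ofRows_apply, Finsupp.comapDomain_apply]

/-! ### Generators and `ID`-primitive forms -/

namespace System

variable {K : Type*} [Field K] {n : ℕ} [Differential K] {S : System K n}

theorem sum_diffOp_apply {T : Fin n → DiffOp K (Fin n)} {τ : Fin n → ℕ →₀ K}
    (h : ∀ i f, (T i).1 f = op D f (τ i)) :
    ∑ i, (T i).1 (X (i, 0) - C (S.a i)) = S.aff (ofRows τ) := by
  rw [ofRows, map_sum]
  refine Finset.sum_congr rfl fun i _ => ?_
  rw [h, aff, Finsupp.linearCombination_mapDomain]
  rfl

variable {α : Fin n × ℕ →₀ K}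

/-- If `M` divides all components on the left, then `α = Mβ`. As `M ≠ 0` and `M` applied to `formMap
β` is zero, `β` is in the kernel, so `β = tα` and `M t = 1`: the greatest common left divisor is
`1`. -/
theorem IsGenerator.isIDPrimitive (hα : S.IsGenerator α) : S.IsIDPrimitive (S.aff α) := by
  obtain ⟨τ, rfl⟩ := exists_ofRows_eq α
  choose T hT using fun i => exists_diffOp (ι := Fin n) (τ i)
  refine ⟨T, (sum_diffOp_apply hT).symm, 1, ⟨fun i => one_dvd _, fun M hM => ?_⟩, 1, fun f => ?_⟩
  · choose B hB using hM
    obtain ⟨m, hm⟩ := exists_op_eq M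
    choose β hβ using fun i => exists_op_eq (B i)
    have h1 : S.aff (ofRows τ) = S.aff (op shiftDeriv (ofRows β) m) := by
      rw [aff_op, ← hm, ← sum_diffOp_apply hT, ← sum_diffOp_apply hβ, map_sum]
      exact Finset.sum_congr rfl fun i _ => by rw [hB, DiffOp.mul_apply]
    have h2 := S.aff_injective h1
    have h3 : S.formMap (ofRows β) = 0 := by
      by_contra hne
      have h4 := hα.formMap_eq_zero
      rw [h2, formMap_op] at h4
      have : m = 0 := op_shiftDeriv_injective hne (by rw [h4, map_zero])
      exact hα.1 (by rw [h2, this, map_zero])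
    obtain ⟨t, ht⟩ := (hα.2 _).mp h3
    obtain ⟨W, hW⟩ := exists_diffOp (ι := Fin n) t
    refine ⟨W, ?_⟩
    have h5 : op opDeriv t m = Finsupp.single 0 1 := by
      refine op_shiftDeriv_injective hα.1 ?_
      rw [← op_shiftDeriv_op_shiftDeriv, ← ht, ← h2, op_single, one_smul]
      rfl
    refine DiffOp.ext fun f => ?_
    rw [DiffOp.mul_apply, hm, hW, op_D_op_D, h5, op_single, one_smul]
    rfl
  · rw [map_one, one_mul]
    rfl

theorem IsGenerator.smul (hα : S.IsGenerator α) {c : K} (hc : c ≠ 0) :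
    S.IsGenerator (c • α) := by
  refine ⟨smul_ne_zero hc hα.1, fun b => (hα.2 b).trans ⟨?_, ?_⟩⟩
  · rintro ⟨t, rfl⟩
    refine ⟨op opDeriv (Finsupp.single 0 c⁻¹) t, ?_⟩
    rw [← op_shiftDeriv_op_shiftDeriv, op_single]
    simp [smul_smul, inv_mul_cancel₀ hc]
  · rintro ⟨t, rfl⟩
    refine ⟨op opDeriv (Finsupp.single 0 c) t, ?_⟩
    rw [← op_shiftDeriv_op_shiftDeriv, op_single]
    rfl

/-- Write `A = tα`. Then `t` is a common left divisor of the components, which `A` determines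
uniquely, so `t` divides a nonzero constant and has order zero. -/
theorem IsGenerator.of_isIDPrimitive (hα : S.IsGenerator α) {A : DiffPoly K (Fin n)} (hA0 : A ≠ 0)
    (hdeg : A.totalDegree ≤ 1) (hA : A ∈ S.ID) (hprim : S.IsIDPrimitive A) :
    ∃ β, S.IsGenerator β ∧ A = S.aff β := by
  obtain ⟨b, hb, rfl⟩ := S.exists_aff_of_mem_ID hA hdeg
  obtain ⟨t, rfl⟩ := (hα.2 b).mp hb
  obtain ⟨T, hTA, L, ⟨hLT, hL⟩, c, hc⟩ := hprim
  obtain ⟨W, hW⟩ := exists_diffOp (ι := Fin n) t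
  obtain ⟨τ, rfl⟩ := exists_ofRows_eq α
  choose B hB using fun i => exists_diffOp (ι := Fin n) (τ i)
  choose σ hσ using fun i => exists_op_eq (T i)
  have hWB : ∀ i f, (W * B i).1 f = op D f (op opDeriv (τ i) t) := fun i f => by
    rw [DiffOp.mul_apply, hW, hB, op_D_op_D]
  have h1 : ofRows (fun i => op opDeriv (τ i) t) = ofRows σ := by
    refine S.aff_injective ?_
    rw [← sum_diffOp_apply hWB, ← sum_diffOp_apply hσ, ← hTA, aff_op, ← sum_diffOp_apply hB, ← hW,
      map_sum]
    rfl
  obtain ⟨M, hM⟩ := hL W fun i => ⟨B i, DiffOp.ext fun f => by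
    rw [hWB, hσ]
    congr 1
    ext k
    rw [← ofRows_apply (fun i => op opDeriv (τ i) t), h1, ofRows_apply]⟩
  obtain ⟨m, hm⟩ := exists_op_eq M
  have h2 : op shiftDeriv (op shiftDeriv (ofRows τ) m) t = c • ofRows τ := by
    refine S.aff_injective ?_
    rw [aff_op, aff_op, ← hm, ← hW, map_smul, MvPolynomial.smul_eq_C_mul, ← hc, hM]
    rfl
  have ht0 : t ≠ 0 := by rintro rfl; exact hA0 (by rw [map_zero, map_zero])
  have hc0 : c ≠ 0 := by
    rintro rfl
    refine hA0 (hTA.trans (Finset.sum_eq_zero fun i _ => ?_))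
    obtain ⟨Q, hQ⟩ := hLT i
    rw [hQ, DiffOp.mul_apply, hc, C_0, zero_mul]
  have hm0 : m ≠ 0 := by
    rintro rfl
    rw [map_zero, op_zero (map_zero _)] at h2
    exact smul_ne_zero hc0 hα.1 h2.symm
  obtain ⟨⟨i, k⟩, hk⟩ := Finsupp.ne_iff.mp hα.1
  obtain ⟨k, hk, htop⟩ := exists_top_row hk
  obtain ⟨d, hd, hdtop⟩ := exists_top_finsupp hm0
  obtain ⟨e, he, hetop⟩ := exists_top_finsupp ht0
  -- Orders are compared in `t(mα) = cα`: the left side has order `k + d + e` in row `i`, the right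
  -- side at most `k`.
  obtain ⟨h3, h4⟩ := op_shiftDeriv_top htop hdtop
  have h5 := (op_shiftDeriv_top h4 hetop).1
  rw [h2, h3, Finsupp.smul_apply, smul_eq_mul] at h5
  have he0 : e = 0 := by
    by_contra hne
    rw [htop _ (by omega), mul_zero] at h5
    exact mul_ne_zero he (mul_ne_zero hd hk) h5.symm
  subst he0
  have ht : t = Finsupp.single 0 (t 0) := by
    ext l
    rcases Nat.eq_zero_or_pos l with rfl | hl
    · rw [Finsupp.single_eq_same]
    · rw [hetop l hl, Finsupp.single_eq_of_ne hl.ne']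
  refine ⟨t 0 • ofRows τ, hα.smul he, ?_⟩
  rw [ht, op_single]
  simp

end System

/-! ### The ideal `(PS)` -/

namespace System

variable {K : Type*} [Field K] {n : ℕ}

theorem mem_supported_varsX {S : System K n} {f : DiffPoly K (Fin n)}
    (h : inX f ∈ supported K S.varsXU) : f ∈ supported K S.varsX := by
  classical
  rw [mem_supported] at h ⊢
  intro v hv
  obtain ⟨a, ha, hva⟩ := (mem_vars_iff_mem_support _).mp hv
  have hv' : varX v ∈ (inX f).vars := by
    refine (mem_vars_iff_mem_support _).mpr ⟨Finsupp.mapDomain varX a, ?_, ?_⟩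
    · rw [support_inX]
      exact Finset.mem_image_of_mem _ ha
    · rw [Finsupp.mem_support_iff, Finsupp.mapDomain_apply varX_injective]
      exact Finsupp.mem_support_iff.mp hva
  rcases h hv' with ⟨w, hw, hwv⟩ | ⟨w, hw, hwv⟩
  · rwa [← varX_injective hwv]
  · simp [varX] at hwv

/-- Every `u_jl` ranks above every `x_ik`, so none can occur below a leading monomial `x_ik`. -/
theorem exists_inX_eq {f : DiffPoly K (Fin n ⊕ Fin (n - 1))} {v : Fin n × ℕ}
    (h : (lexStar n).degree f = Finsupp.single (varX v) 1) : ∃ g, inX g = f := by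
  refine exists_rename_eq_of_vars_subset_range f _ varX_injective fun x hx => ?_
  obtain ⟨a, ha, hxa⟩ := (mem_vars_iff_mem_support _).mp hx
  have h1 := (lexStar n).le_degree ha
  rw [h] at h1
  have h2 := rankStar_le_of_le_single h1 (Finsupp.mem_support_iff.mp hxa)
  obtain ⟨i | j, k⟩ := x
  · exact ⟨(i, k), rfl⟩
  · exact absurd h2 (Sum.Lex.not_inr_le_inl)

theorem inX_X (v : Fin n × ℕ) :
    inX (X v : DiffPoly K (Fin n)) = X ((Sum.inl v.1, v.2) : (Fin n ⊕ Fin (n - 1)) × ℕ) :=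
  rename_X _ v

theorem varsX_lower (S : System K n) (i : Fin n) (k l : ℕ) (hl : l ≤ k) (h : (i, k) ∈ S.varsX) :
    (i, l) ∈ S.varsX := by
  simp only [varsX, Set.mem_ofPred_eq] at h ⊢
  omega

variable [Differential K] (S : System K n)

/-- The substitution `x_i ↦ P_i(U)` in `K{X ∪ U}`. -/
def evalXU : DiffPoly K (Fin n ⊕ Fin (n - 1)) →ₐ[K] DiffPoly K (Fin (n - 1)) :=
  aeval fun v => Sum.elim (fun i => D^[v.2] (S.P i)) (fun j => X (j, v.2)) v.1

theorem evalXU_inX (f : DiffPoly K (Fin n)) : S.evalXU (inX f) = S.eval f := by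
  rw [evalXU, inX, aeval_rename]
  rfl

theorem evalXU_inU (f : DiffPoly K (Fin (n - 1))) : S.evalXU (inU (n := n) f) = f := by
  rw [evalXU, inU, aeval_rename]
  exact aeval_X_left_apply f

theorem evalXU_D (f : DiffPoly K (Fin n ⊕ Fin (n - 1))) :
    S.evalXU (D f) = D (S.evalXU f) := by
  have hC : ∀ c, S.evalXU (C c) = C c := AlgHom.commutes S.evalXU
  induction f using MvPolynomial.induction_on with
  | C c => rw [D_C, hC, hC, D_C]
  | add p q hp hq => simp only [map_add, hp, hq]
  | mul_X p v hp =>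
    have hX : S.evalXU (X (v.1, v.2 + 1)) = D (S.evalXU (X v)) := by
      obtain ⟨i | j, k⟩ := v
      · simp only [evalXU, aeval_X, Sum.elim_inl, Function.iterate_succ_apply']
      · simp only [evalXU, aeval_X, Sum.elim_inr, D_X]
    simp only [Derivation.leibniz, map_mul, map_add, smul_eq_mul, hp, D_X, hX]

theorem evalXU_iterate_D_F (i : Fin n) (k : ℕ) : S.evalXU (D^[k] (S.F i)) = 0 := by
  have h : S.evalXU (S.F i) = 0 := by
    rw [F, map_sub, evalXU_inU, show X (Sum.inl i, 0) = inX (X (i, 0) : DiffPoly K (Fin n)) from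
      (inX_X (i, 0)).symm, evalXU_inX, eval_X]
    exact sub_self _
  rw [Function.Semiconj.iterate_right (f := S.evalXU) (ga := D) (gb := D) S.evalXU_D k, h]
  exact Function.iterate_fixed (map_zero _) k

variable {S}

theorem evalXU_eq_zero {f : DiffPoly K (Fin n ⊕ Fin (n - 1))} (hf : f ∈ S.idealPS) :
    S.evalXU f = 0 := by
  induction hf using Submodule.span_induction with
  | mem f hf =>
    obtain ⟨i, k, -, rfl⟩ := hf
    exact S.evalXU_iterate_D_F i k
  | zero => exact map_zero _
  | add f g _ _ hf hg => rw [map_add, hf, hg, add_zero]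
  | smul r f _ hf => rw [Algebra.smul_def, map_mul, hf, mul_zero]

theorem mem_ID_of_inX_mem {f : DiffPoly K (Fin n)} (hf : inX f ∈ S.idealPS) : f ∈ S.ID := by
  rw [mem_ID, ← evalXU_inX]
  exact evalXU_eq_zero hf

theorem mem_supported_of_mem_idealPS {f : DiffPoly K (Fin n ⊕ Fin (n - 1))}
    (hf : f ∈ S.idealPS) : f ∈ supported K S.varsXU := by
  induction hf using Submodule.span_induction with
  | mem f hf => exact S.PS_subset hf
  | zero => exact zero_mem _
  | add f g _ _ hf hg => exact add_mem hf hg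
  | smul r f _ hf => exact mul_mem r.2 hf

theorem D_rename {ι κ : Type*} (g : ι → κ) (f : DiffPoly K ι) :
    D (rename (fun v => (g v.1, v.2)) f : DiffPoly K κ) =
      rename (fun v : ι × ℕ => (g v.1, v.2)) (D f) := by
  induction f using MvPolynomial.induction_on with
  | C c => rw [D_C, rename_C, rename_C, D_C]
  | add p q hp hq => simp only [map_add, hp, hq]
  | mul_X p v hp =>
    simp only [Derivation.leibniz, map_mul, map_add, smul_eq_mul, hp, D_X, rename_X]

theorem iterate_D_inX (f : DiffPoly K (Fin n)) (k : ℕ) : D^[k] (inX f) = inX (D^[k] f) :=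
  (Function.Semiconj.iterate_right (f := inX) (ga := D) (gb := D)
    (fun f => (D_rename Sum.inl f).symm) k f).symm

theorem iterate_D_inU (f : DiffPoly K (Fin (n - 1))) (k : ℕ) :
    D^[k] (inU (n := n) f) = inU (D^[k] f) :=
  (Function.Semiconj.iterate_right (f := inU) (ga := D) (gb := D)
    (fun f => (D_rename Sum.inr f).symm) k f).symm

theorem iterate_D_F (i : Fin n) (k : ℕ) :
    D^[k] (S.F i) = inX (X (i, k)) - inU (D^[k] (S.P i)) := by
  have hsub : ∀ k (f g : DiffPoly K (Fin n ⊕ Fin (n - 1))), D^[k] (f - g) = D^[k] f - D^[k] g := by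
    intro k
    induction k with
    | zero => exact fun _ _ => rfl
    | succ k ih => exact fun f g => by rw [Function.iterate_succ_apply, map_sub, ih]; rfl
  have hX := iterate_D_X_sub_C i (0 : K) k
  rw [C_0, sub_zero, Function.iterate_fixed (f := fun a : K => a′) (map_zero _) k, C_0,
    sub_zero] at hX
  rw [F, hsub, iterate_D_inU, show X (Sum.inl i, 0) = inX (X (i, 0) : DiffPoly K (Fin n)) from
      (inX_X (i, 0)).symm, iterate_D_inX, hX]

/-- This is `x_ik = ∂^k F_i + ∂^k P_i` extended linearly. For kernel forms the last term vanishes,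
leaving an explicit combination of the `∂^k F_i`. -/
theorem inX_aff (b : Fin n × ℕ →₀ K) :
    inX (S.aff b) = Finsupp.linearCombination K (fun v => D^[v.2] (S.F v.1)) b +
      inU (lin (S.formMap b)) := by
  induction b using Finsupp.induction_linear with
  | zero => simp
  | add s t hs ht => simp only [map_add, hs, ht]; ring
  | single v c =>
    have hC : ∀ a : K, (inX (C a) : DiffPoly K (Fin n ⊕ Fin (n - 1))) = inU (C a) := fun a =>
      (rename_C _ a).trans (rename_C _ a).symm
    rw [aff_single, Finsupp.linearCombination_single, iterate_D_F, iterate_D_P, formMap,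
      Finsupp.linearCombination_single, map_smul, map_smul, map_smul, ← smul_add, map_sub, map_add,
      hC]
    congr 1
    ring

theorem inX_aff_mem_idealPS {b : Fin n × ℕ →₀ K} (hb : S.formMap b = 0) :
    inX (S.aff b) ∈ S.idealPS ↔ b ∈ Finsupp.supported K K S.varsX := by
  constructor
  · intro h
    exact S.aff_mem_supported.mp (mem_supported_varsX (mem_supported_of_mem_idealPS h))
  · intro h
    rw [inX_aff, hb, map_zero, map_zero, add_zero, Finsupp.linearCombination_apply]
    refine Submodule.sum_mem _ fun v hv => ?_
    exact Submodule.smul_of_tower_mem _ _ (Submodule.subset_span ⟨v.1, v.2, h hv, rfl⟩)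

variable {α : Fin n × ℕ →₀ K}

theorem IsGenerator.mem_idealPS_iff (hα : S.IsGenerator α) (k : ℕ) :
    inX (D^[k] (S.aff α)) ∈ S.idealPS ↔
      shiftDeriv^[k] α ∈ Finsupp.supported K K S.varsX := by
  rw [iterate_D_aff, inX_aff_mem_idealPS (hα.formMap_iterate k)]

/-- The admissible orders contain `0` by `mem_varsX` and are bounded since the leader moves up. They
form an initial segment because row tops rise with each derivative and `𝒳` is closed under lowering
orders. -/
theorem IsGenerator.exists_isCoOrder (hα : S.IsGenerator α) :
    ∃ c, S.IsCoOrder (S.aff α) c ∧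
      ∀ k, shiftDeriv^[k] α ∈ Finsupp.supported K K S.varsX ↔ k ≤ c := by
  set s : Set ℕ := {k | inX (D^[k] (S.aff α)) ∈ S.idealPS} with hs
  have hmem : ∀ k, k ∈ s ↔ shiftDeriv^[k] α ∈ Finsupp.supported K K S.varsX := hα.mem_idealPS_iff
  have hne : s.Nonempty := ⟨0, (hmem 0).mpr fun v hv => hα.mem_varsX (Finsupp.mem_support_iff.mp hv)⟩
  have hbdd : BddAbove s := by
    obtain ⟨v, hv⟩ := exists_isLead hα.1
    refine ⟨((S.N : ℤ) - S.o v.1 - S.gamma).toNat, fun k hk => ?_⟩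
    have := (hmem k).mp hk (Finsupp.mem_support_iff.mpr (hv.iterate k).1)
    simp only [varsX, Set.mem_ofPred_eq] at this
    omega
  have hgreat : IsGreatest s (sSup s) := ⟨Nat.sSup_mem hne hbdd, fun k hk => le_csSup hbdd hk⟩
  refine ⟨sSup s, hgreat, fun k => ⟨fun hk => hgreat.2 ((hmem k).mpr hk), fun hk => ?_⟩⟩
  rintro ⟨i, l⟩ hl
  obtain ⟨k₁, hk₁, hle⟩ := exists_of_iterate_shiftDeriv_ne_zero (Finsupp.mem_support_iff.mp hl)
  obtain ⟨k₂, hk₂, htop⟩ := exists_top_row hk₁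
  have hk₁₂ : k₁ ≤ k₂ := by
    by_contra hlt
    exact hk₁ (htop _ (not_le.mp hlt))
  refine S.varsX_lower i (k₂ + sSup s) l (by simp only at hle; omega) ?_
  refine (hmem _).mp hgreat.1 (Finsupp.mem_support_iff.mpr ?_)
  rw [(iterate_shiftDeriv_top htop _).1]
  exact hk₂

/-! ### The Gröbner basis -/

theorem IsGenerator.groebner (hα : S.IsGenerator α)
    {G : Set (DiffPoly K (Fin n ⊕ Fin (n - 1)))} (hG : S.IsAssociatedGroebnerBasis G) :
    S.aff α ∈ S.idealPartX G ∧ ∃ c : ℕ, S.IsCoOrder (S.aff α) c ∧ (partX G).encard = c + 1 := by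
  obtain ⟨c, hc, hcle⟩ := hα.exists_isCoOrder
  obtain ⟨v, hv⟩ := exists_isLead hα.1
  have hmemID : ∀ g ∈ partX G, g ∈ S.ID := fun g hg => mem_ID_of_inX_mem (hG.subset hg)
  have hmemX : ∀ g ∈ partX G, g ∈ supported K S.varsX := fun g hg =>
    mem_supported_varsX (mem_supported_of_mem_idealPS (hG.subset hg))
  have hlead : ∀ f, f ∈ S.ID → f ∈ supported K S.varsX → f ≠ 0 →
      ∃ k ≤ c, Finsupp.single (varX (v.1, v.2 + k)) 1 ≤ (lexStar n).degree (inX f) := by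
    intro f h1 h2 h3
    obtain ⟨w, ⟨k, rfl, hk⟩, hw⟩ := hα.exists_degree_ne_zero hv S.varsX_lower h1 h2 h3
    exact ⟨k, (hcle k).mp hk, Finsupp.single_le_iff.mpr (Nat.one_le_iff_ne_zero.mpr hw)⟩
  have hex : ∀ k, ∃ g, k ≤ c → g ∈ partX G ∧
      (lexStar n).degree (inX g) = Finsupp.single (varX (v.1, v.2 + k)) 1 := by
    intro k
    by_cases hk : k ≤ c
    · have hdeg := degree_inX_aff S (hv.iterate k)
      have hmem := (inX_aff_mem_idealPS (hα.formMap_iterate k)).mpr ((hcle k).mpr hk)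
      obtain ⟨g, hg, hle⟩ := hG.exists_degree_le _ hmem fun h0 => by
        rw [h0, MonomialOrder.degree_zero] at hdeg
        simpa using hdeg.symm
      rw [hdeg] at hle
      have hg1 : (lexStar n).degree g = Finsupp.single (varX (v.1, v.2 + k)) 1 := by
        -- A proper divisor of a variable is `1`; a monic `g` of degree zero would put `1` in
        -- `(PS)`, which the substitution excludes.
        by_contra hne
        have h0 : (lexStar n).degree g = 0 := by
          refine (Finsupp.degree_eq_zero_iff _).mp ?_
          by_contra h0
          refine hne ?_
          obtain ⟨r, hr⟩ := exists_add_of_le hle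
          have hd := congrArg Finsupp.degree hr
          rw [map_add, Finsupp.degree_single] at hd
          have : r = 0 := (Finsupp.degree_eq_zero_iff r).mp (by omega)
          rw [hr, this, add_zero]
        have h1 := MonomialOrder.eq_C_of_degree_eq_zero h0
        rw [(hG.monic g hg).leadingCoeff_eq_one] at h1
        have h2 := evalXU_eq_zero (hG.subset hg)
        rw [h1, C_1, map_one] at h2
        exact one_ne_zero h2
      obtain ⟨g, rfl⟩ := exists_inX_eq hg1
      exact ⟨g, fun _ => ⟨hg, hg1⟩⟩
    · exact ⟨0, fun h => absurd h hk⟩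
  choose g hg using hex
  refine ⟨?_, c, hc, ?_⟩
  · obtain ⟨hg0, hgdeg⟩ := hg 0 (Nat.zero_le c)
    rw [add_zero] at hgdeg
    -- Subtraction cancels the lowest leader, yet a nonzero difference has a leading monomial
    -- divisible by some leader, hence not below it.
    suffices S.aff α = α v • g 0 by
      rw [this]
      exact Submodule.smul_of_tower_mem _ _ (Submodule.subset_span hg0)
    by_contra hne
    have hαID := S.aff_mem_ID.mpr hα.formMap_eq_zero
    have hαX : S.aff α ∈ supported K S.varsX := S.aff_mem_supported.mpr ((hcle 0).mpr (Nat.zero_le c))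
    set r := S.aff α - α v • g 0 with hr
    have hr0 : r ≠ 0 := sub_ne_zero.mpr hne
    obtain ⟨k, -, hk⟩ := hlead r
      (Ideal.sub_mem _ hαID (Submodule.smul_of_tower_mem _ _ (hmemID _ hg0)))
      (sub_mem hαX (Subalgebra.smul_mem _ (hmemX _ hg0) _)) hr0
    have hle : (lexStar n).degree (inX r) ≼[lexStar n] Finsupp.single (varX v) 1 := by
      rw [hr, map_sub, map_smul]
      refine (MonomialOrder.degree_sub_le (m := lexStar n)).trans (sup_le ?_ ?_)
      · rw [degree_inX_aff S hv]
      · exact (MonomialOrder.degree_smul_le (m := lexStar n)).trans (by rw [hgdeg])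
    have hge : Finsupp.single (varX v) 1 ≼[lexStar n] (lexStar n).degree (inX r) := by
      refine le_trans (single_le_single_of_rankStar_le ?_) ((lexStar n).toSyn_monotone hk)
      exact rankStar_varX_le_iff.mpr (Or.inr ⟨rfl, Nat.le_add_right _ _⟩)
    have hdeg := (lexStar n).toSyn.injective (le_antisymm hle hge)
    refine (MonomialOrder.coeff_degree_ne_zero_iff (m := lexStar n)).mpr
      ((map_ne_zero_iff _ inX_injective).mpr hr0) ?_
    have hmon := (hG.monic _ hg0).coeff_degree
    rw [hgdeg] at hmon
    rw [hdeg, hr, map_sub, map_smul, coeff_sub, coeff_smul, hmon, ← Finsupp.mapDomain_single,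
      coeff_inX, coeff_aff, smul_eq_mul, mul_one, sub_self]
  · have hG0 : partX G = g '' Set.Iic c := by
      ext f
      constructor
      · intro hf
        have hf0 : f ≠ 0 := by
          rintro rfl
          exact (hG.monic _ hf).ne_zero (map_zero _)
        obtain ⟨k, hk, hle⟩ := hlead f (hmemID f hf) (hmemX f hf) hf0
        refine ⟨k, hk, ?_⟩
        obtain ⟨h1, h2⟩ := hg k hk
        by_contra hne
        -- The leading monomial of `f` is divisible by that of `g k`, so reducedness forces `f = g
        -- k`.
        refine hG.reduced _ hf _ h1 (fun h => hne (inX_injective h)) _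
          ((lexStar n).degree_mem_support ((map_ne_zero_iff _ inX_injective).mpr hf0)) ?_
        rw [h2]
        exact hle
      · rintro ⟨k, hk, rfl⟩
        exact (hg k hk).1
    have hinj : Set.InjOn g (Set.Iic c) := by
      intro k hk l hl hkl
      have h1 := (hg k hk).2
      rw [hkl, (hg l hl).2] at h1
      have := varX_injective (Finsupp.single_left_injective one_ne_zero h1)
      simp only [Prod.mk.injEq, true_and] at this
      omega
    rw [hG0, hinj.encard_image, ← Set.coe_fintypeCard, Fintype.card_Iic, Nat.card_Iic]
    norm_cast

end System

end

end LinearDPPE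

theorem mainTheorem3 {K : Type*} [Field K] [Differential K] {n : ℕ}
    (S : LinearDPPE.System K n)
    (G : Set (LinearDPPE.DiffPoly K (Fin n ⊕ Fin (n - 1))))
    (hG : S.IsAssociatedGroebnerBasis G)
    (hdim : LinearDPPE.HasDiffDim S.ID (n - 1)) :
    (∃ A : LinearDPPE.DiffPoly K (Fin n),
      A ≠ 0 ∧ A.totalDegree ≤ 1 ∧ S.ID = LinearDPPE.diffIdeal {A} ∧
      S.IsIDPrimitive A ∧ A ∈ S.idealPartX G ∧
      ∃ c : ℕ, S.IsCoOrder A c ∧ (LinearDPPE.System.partX G).encard = c + 1) ∧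
    (∀ A : LinearDPPE.DiffPoly K (Fin n),
      A ≠ 0 → A.totalDegree ≤ 1 → S.IsIDPrimitive A → A ∈ S.idealPartX G →
      S.ID = LinearDPPE.diffIdeal {A} ∧
      ∃ c : ℕ, S.IsCoOrder A c ∧ (LinearDPPE.System.partX G).encard = c + 1) := by
  obtain ⟨α, hα⟩ := S.exists_isGenerator hdim
  refine ⟨⟨S.aff α, (map_ne_zero_iff _ S.aff_injective).mpr hα.1, S.totalDegree_aff_le α, hα.ID_eq,
    hα.isIDPrimitive, (hα.groebner hG).1, (hα.groebner hG).2⟩, fun A hA0 hdeg hprim hA => ?_⟩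
  -- Since `𝒢₀ ⊆ (PS)` and the substitution kills `(PS)`, the ideal `(𝒢₀)` lies in `ID`.
  have hAID : A ∈ S.ID := by
    clear hA0 hdeg hprim
    induction hA using Submodule.span_induction with
    | mem f hf => exact LinearDPPE.System.mem_ID_of_inX_mem (hG.subset hf)
    | zero => exact zero_mem _
    | add f g _ _ hf hg => exact add_mem hf hg
    | smul r f _ hf => exact Ideal.mul_mem_left _ _ hf
  obtain ⟨β, hβ, rfl⟩ := hα.of_isIDPrimitive hA0 hdeg hAID hprim
  exact ⟨hβ.ID_eq, (hβ.groebner hG).2⟩
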